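/- Let $m>0$, $r\in\mathbb{R}$, $\mathbb{I}=\mathrm{diag}(I_1,I_2,I_3)$ with $I_i>0$, let $E$ be the $3\times3$ identity matrix and $e_3=(0,0,1)^T$. Let $A$ be a real $3\times 3$ matrix of rank $j\in\{0,1,2,3\}$ of the form $A=\begin{pmatrix}C&0\\0&1\end{pmatrix}$ with $C\in SO(2)$ if $j=3$; $A=\begin{pmatrix}C&0\\0&0\end{pmatrix}$ with $C\in SO(2)$ if $j=2$; $A=e_3e_3^T$ if $j=1$; $A=0$ if $j=0$. **Setting.** Let $Q=SO(3)\times\mathbb{R}^3\ni(g,x)$, let $\lambda$ be the $\mathbb{R}^3$-valued left Maurer–Cartan form of $SO(3)$ ($\widehat{\lambda(\dot g)}=g^{-1}\dot g$), and $\Omega=\lambda(\dot g)$. Consider the Lagrangian $\frac12\mathbb{I}\Omega\cdot\Omega+\frac m2\|\dot x\|^2$ on $TQ$ and the constraint $\dot x=rAg\Omega$, that is, $\epsilon:=dx-rAg\lambda=0$. Write covectors as $M\cdot\lambda+p\cdot dx$; the Legendre transform is $M=\mathbb{I}\Omega$, $p=m\dot x$. Let $\mathcal M\subset T^*Q$ be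 the image of the constraint distribution under the Legendre transform, $\mathcal H_{\mathcal M}$ the restriction of the Hamiltonian to $\mathcal M$, $\Omega_{\mathcal M}$ the pull-back to $\mathcal M$ of the canonical form $\Omega_Q=-d(M\cdot\lambda+p\cdot dx)$, and $\mathcal C\subset T\mathcal M$ the distribution of tangent vectors annihilated by (the pull-back of) $\epsilon$. For a bivector field $\pi$, $\pi^\sharp$ is defined by $\beta(\pi^\sharp\alpha)=\pi(\alpha,\beta)$, its bracket is $\{f,g\}=\pi(df,dg)$, and $X_f=-\pi^\sharp(df)$. The nonholonomic bivector field $\pi_{nh}$ on $\mathcal M$ is the one with $\pi_{nh}^\sharp(\alpha)=-X$ if and only if $X\in\mathcal C$ and $(i_X\Omega_{\mathcal M})|_{\mathcal C}=\alpha|_{\mathcal C}$. For a 2-form $B$ on $\mathcal M$, the gauge transformation of $\pi_{nh}$ by $B$ is the bivector field $\pi^B_{nh}$, if it exists, with $\mathrm{graph}((\pi^B_{nh})^\sharp)=\{(X,\alpha+i_XB): X=\pi_{nh}^\sharp(\alpha)\}$; it is a dynamical gauge transformation if moreover $i_{X_{\mathcal H_{\mathcal M}}}B=0$. Take $B=-mr^2\,\Omega\cdot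 d\lambda$, where $\Omega=\mathbb{I}^{-1}M$. The group $H=\{(h,y)\in SE(3): he_3=e_3\}$ acts on $Q$ by $(h,y)(g,x)=(hg,hx+y)$ and on $T^*Q$ by the cotangent lift. Let $\rho:\mathcal M\to S^2\times\mathbb{R}^3$ be $\rho=(\gamma,K)$ with $\gamma=g^{-1}e_3$ and $K=M+rg^TA^Tp=\mathbb{I}\Omega+mr^2g^TA^TAg\,\Omega$. **Brackets.** For $F,G\in C^\infty(\mathbb{R}^3\times\mathbb{R}^3)$, functions of $(\gamma,K)$, put $$\{F,G\}'_{\mathrm{Rank}\,j}=-W_j\cdot\Big(\frac{\partial F}{\partial K}\times\frac{\partial G}{\partial K}\Big)-\gamma\cdot\Big(\frac{\partial F}{\partial K}\times\frac{\partial G}{\partial\gamma}-\frac{\partial G}{\partial K}\times\frac{\partial F}{\partial\gamma}\Big),$$ with $W_0=K-mr^2\Omega$, $W_1=K-mr^2\Omega+mr^2(\Omega\cdot\gamma)\gamma$, $W_2=K-mr^2(\Omega\cdot\gamma)\gamma$, $W_3=K$, where $\Omega$ is the following function of $(\gamma,K)$: for $j=0$, $\Omega=\mathbb{I}^{-1}K$;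 for $j=1$, $\Omega=\mathbb{I}^{-1}K-mr^2\frac{K\cdot\mathbb{I}^{-1}\gamma}{\|\gamma\|^2+mr^2\gamma\cdot\mathbb{I}^{-1}\gamma}\mathbb{I}^{-1}\gamma$; for $j=2$, with $\mathbb J=\mathbb{I}+mr^2E$, $\Omega=\mathbb J^{-1}K+mr^2\frac{K\cdot\mathbb J^{-1}\gamma}{\|\gamma\|^2-mr^2\gamma\cdot\mathbb J^{-1}\gamma}\mathbb J^{-1}\gamma$; for $j=3$, $\Omega=(\mathbb{I}+mr^2E)^{-1}K$. **Theorem.** The group $H$ preserves $\mathcal M$, and $\rho$ is a surjective submersion onto $\mathcal R:=S^2\times\mathbb{R}^3$ whose fibres are exactly the $H$-orbits, so that $\mathcal R=\mathcal M/H$. The function $\|\gamma\|^2$ is a Casimir of $\{\cdot,\cdot\}'_{\mathrm{Rank}\,j}$. The nonholonomic bivector field $\pi_{nh}$ exists and is unique; $B$ defines a dynamical gauge transformation of it, and $\pi^B_{nh}$ is unique. There is exactly one bracket $\{\cdot,\cdot\}_{red^B}$ on $C^\infty(\mathcal R)$ with $\{f,g\}_{red^B}\circ\rho=\{f\circ\rho,g\circ\rho\}^B_{nh}$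 for all $f,g\in C^\infty(\mathcal R)$, and this reduced bracket is precisely the restriction of $\{\cdot,\cdot\}'_{\mathrm{Rank}\,j}$ to the Casimir level set $\|\gamma\|=1$. -/

import Mathlib

open scoped Matrix ContDiff

noncomputable section

/-! ## Calculus on embedded submanifolds

All manifolds below are embedded submanifolds `S` of a finite-dimensional real vector space `E`. -/

namespace Embedded

variable {E : Type*} [NormedAddCommGroup E] [NormedSpace ℝ E]
variable {E' : Type*} [NormedAddCommGroup E'] [NormedSpace ℝ E']

/-- Velocities at `z` of smooth curves that stay in `S`. -/
def velocities (S : Set E) (z : E) : Set E :=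
  {v | ∃ c : ℝ → E, ContDiff ℝ ∞ c ∧ (∀ t, c t ∈ S) ∧ c 0 = z ∧ deriv c 0 = v}

/-- The tangent space `T_z S` (for a submanifold the velocities already form a subspace). -/
def tangentSpace (S : Set E) (z : E) : Submodule ℝ E :=
  Submodule.span ℝ (velocities S z)

/-- The cotangent space `T_z^* S`. -/
abbrev Cotangent (S : Set E) (z : E) : Type _ := Module.Dual ℝ (tangentSpace S z)

/-- `f : S → ℝ` is smooth if near each point of `S` it extends to a smooth function on an open
subset of the ambient space. -/
def IsSmooth (S : Set E) (f : S → ℝ) : Prop :=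
  ∀ z : S, ∃ F : E → ℝ, ∃ U : Set E, IsOpen U ∧ (z : E) ∈ U ∧ ContDiffOn ℝ ∞ F U ∧
    ∀ w : S, (w : E) ∈ U → f w = F w

/-- The algebra `C^∞(S)`, as a type. -/
def SmoothFn (S : Set E) : Type _ := {f : S → ℝ // IsSmooth S f}

instance (S : Set E) : CoeFun (SmoothFn S) (fun _ => S → ℝ) := ⟨Subtype.val⟩

/-- The restriction to `S` of a smooth function on the ambient space. -/
def SmoothFn.restrict (S : Set E) (F : E → ℝ) (hF : ContDiff ℝ ∞ F) : SmoothFn S :=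
  ⟨fun z => F z, fun _ => ⟨F, Set.univ, isOpen_univ, Set.mem_univ _, hF.contDiffOn,
    fun _ _ => rfl⟩⟩

/-- The pull-back `P^* f = f ∘ P` along a smooth map `P` that carries `S` into `S'`. -/
def SmoothFn.pullback {S : Set E} {S' : Set E'} (P : E → E') (hP : ContDiff ℝ ∞ P)
    (hS : Set.MapsTo P S S') (f : SmoothFn S') : SmoothFn S :=
  ⟨fun z => f ⟨P z, hS z.2⟩, fun z => by
    obtain ⟨F, U, hU, hz, hF, hfF⟩ := f.2 ⟨P z, hS z.2⟩
    refine ⟨F ∘ P, P ⁻¹' U, hU.preimage hP.continuous, hz,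
      hF.comp hP.contDiffOn (fun _ h => h), fun w hw => ?_⟩
    exact hfF ⟨P w, hS w.2⟩ hw⟩

/-- The differential `df_z ∈ T_z^* S`: the derivative of a smooth extension of `f`, restricted to
the tangent space. It does not depend on the extension, see `differential_apply`. -/
def differential {S : Set E} (f : SmoothFn S) (z : S) : Cotangent S z :=
  (fderiv ℝ (Classical.choose (f.2 z)) z).toLinearMap ∘ₗ (tangentSpace S (z : E)).subtype

theorem hasDerivAt_along {S : Set E} (f : S → ℝ) (z : S) (F : E → ℝ) (U : Set E)
    (hU : IsOpen U) (hz : (z : E) ∈ U) (hF : ContDiffOn ℝ ∞ F U)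
    (hfF : ∀ w : S, (w : E) ∈ U → f w = F w) (c : ℝ → E) (hc : ContDiff ℝ ∞ c)
    (hcS : ∀ t, c t ∈ S) (h0 : c 0 = z) :
    HasDerivAt (fun t => f ⟨c t, hcS t⟩) (fderiv ℝ F z (deriv c 0)) 0 := by
  have hFd : HasFDerivAt F (fderiv ℝ F z) (c 0) := by
    rw [h0]
    exact ((hF.contDiffAt (hU.mem_nhds hz)).differentiableAt (by simp)).hasFDerivAt
  have hcd : HasDerivAt c (deriv c 0) 0 :=
    ((hc.differentiable (by simp)) 0).hasDerivAt
  refine (hFd.comp_hasDerivAt (0 : ℝ) hcd).congr_of_eventuallyEq ?_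
  have hmem : c ⁻¹' U ∈ nhds (0 : ℝ) :=
    (hU.preimage hc.continuous).mem_nhds (by simpa [h0] using hz)
  filter_upwards [hmem] with t ht
  exact hfF ⟨c t, hcS t⟩ ht

/-- The differential may be computed from any local smooth extension. -/
theorem differential_apply {S : Set E} (f : SmoothFn S) (z : S) (F : E → ℝ) (U : Set E)
    (hU : IsOpen U) (hz : (z : E) ∈ U) (hF : ContDiffOn ℝ ∞ F U)
    (hfF : ∀ w : S, (w : E) ∈ U → f w = F w) (v : tangentSpace S (z : E)) :
    differential f z v = fderiv ℝ F z v := by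
  obtain ⟨U', hU', hz', hF', hfF'⟩ := Classical.choose_spec (f.2 z)
  obtain ⟨v, hv⟩ := v
  change fderiv ℝ (Classical.choose (f.2 z)) z v = fderiv ℝ F z v
  induction hv using Submodule.span_induction with
  | mem v hv =>
    obtain ⟨c, hc, hcS, h0, rfl⟩ := hv
    exact (hasDerivAt_along f.1 z _ U' hU' hz' hF' hfF' c hc hcS h0).unique
      (hasDerivAt_along f.1 z F U hU hz hF hfF c hc hcS h0)
  | zero => simp
  | add x y _ _ hx hy => rw [map_add, map_add, hx, hy]
  | smul a x _ hx => rw [map_smul, map_smul, hx]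

/-- A bivector field on `S`: at each point an alternating bilinear form on the cotangent space
(that is, an element of `⋀² T_z S`), such that the function `π(df, dg)` is smooth whenever `f` and
`g` are. -/
structure BivectorField (S : Set E) where
  /-- The bilinear form `(α, β) ↦ π_z(α, β)`. -/
  toFun : ∀ z : S, Cotangent S (z : E) →ₗ[ℝ] Cotangent S (z : E) →ₗ[ℝ] ℝ
  alternating : ∀ z α, toFun z α α = 0
  smooth : ∀ f g : SmoothFn S,
    IsSmooth S (fun z => toFun z (differential f z) (differential g z))

/-- The almost Poisson bracket `{f, g} = π(df, dg)`. -/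
def BivectorField.bracket {S : Set E} (π : BivectorField S) (f g : SmoothFn S) : SmoothFn S :=
  ⟨fun z => π.toFun z (differential f z) (differential g z), π.smooth f g⟩

/-- The map `π^♯ : T_z^* S → T_z S`, characterized by `β (π^♯ α) = π(α, β)`. -/
def BivectorField.sharp [FiniteDimensional ℝ E] {S : Set E} (π : BivectorField S) (z : S) :
    Cotangent S (z : E) →ₗ[ℝ] tangentSpace S (z : E) :=
  (Module.evalEquiv ℝ (tangentSpace S (z : E))).symm.toLinearMap ∘ₗ π.toFun z

theorem BivectorField.apply_sharp [FiniteDimensional ℝ E] {S : Set E} (π : BivectorField S)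
    (z : S) (α β : Cotangent S (z : E)) : β (π.sharp z α) = π.toFun z α β := by
  simp [BivectorField.sharp]

/-- The graph `{(X, α) : X = π^♯ α} ⊆ T_z S ⊕ T_z^* S`. -/
def BivectorField.graph [FiniteDimensional ℝ E] {S : Set E} (π : BivectorField S) (z : S) :
    Set (tangentSpace S (z : E) × Cotangent S (z : E)) :=
  {p | p.1 = π.sharp z p.2}

/-- The (almost) Hamiltonian vector field `X_f = -π^♯(df)`. -/
def BivectorField.hamiltonianVectorField [FiniteDimensional ℝ E] {S : Set E}
    (π : BivectorField S) (f : SmoothFn S) (z : S) : tangentSpace S (z : E) :=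
  - π.sharp z (differential f z)

/-- A differential 2-form on the ambient space; its pull-back to `S` is obtained by evaluating it
on tangent vectors of `S`. -/
abbrev TwoForm (E : Type*) [NormedAddCommGroup E] [NormedSpace ℝ E] : Type _ :=
  E → E [⋀^Fin 2]→L[ℝ] ℝ

/-- The exterior derivative of a 1-form `θ` on the ambient space. -/
def dOneForm (θ : E → E →L[ℝ] ℝ) : TwoForm E :=
  extDeriv (fun z => ContinuousAlternatingMap.ofSubsingleton ℝ E ℝ (0 : Fin 1) (θ z))

/-- `π` is the bivector field associated to the distribution `F` and the restriction to `F` of the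
2-form `σ`: `π^♯ α = -X` if and only if `X ∈ F` and `(i_X σ)|_F = α|_F`. -/
def IsAssociatedBivector [FiniteDimensional ℝ E] {S : Set E}
    (F : ∀ z : S, Submodule ℝ (tangentSpace S (z : E))) (σ : TwoForm E)
    (π : BivectorField S) : Prop :=
  ∀ (z : S) (α : Cotangent S (z : E)) (X : tangentSpace S (z : E)),
    π.sharp z α = -X ↔ X ∈ F z ∧ ∀ Y ∈ F z, σ z ![(X : E), (Y : E)] = α Y

/-- The gauge transformation `τ_B L = {(X, α + i_X B) : (X, α) ∈ L}` at the point `z`. -/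
def gaugeTransform {S : Set E} (B : TwoForm E) (z : S)
    (L : Set (tangentSpace S (z : E) × Cotangent S (z : E))) :
    Set (tangentSpace S (z : E) × Cotangent S (z : E)) :=
  {p | ∃ α, (p.1, α) ∈ L ∧ ∀ Y : tangentSpace S (z : E),
    p.2 Y = α Y + B z ![(p.1 : E), (Y : E)]}

/-- `πB` is the gauge transformation of `π` by `B`: `graph πB = τ_B (graph π)`. -/
def IsGaugeTransformOf [FiniteDimensional ℝ E] {S : Set E} (B : TwoForm E)
    (π πB : BivectorField S) : Prop :=
  ∀ z : S, πB.graph z = gaugeTransform B z (π.graph z)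

/-- `B` defines a dynamical gauge transformation of `π` with respect to the distinguished
Hamiltonian `H`: `i_{X_H} B = 0` on `S`, and `τ_B (graph π)` is again the graph of a bivector
field. -/
def IsDynamicalGauge [FiniteDimensional ℝ E] {S : Set E} (B : TwoForm E) (π : BivectorField S)
    (H : SmoothFn S) : Prop :=
  (∀ (z : S) (Y : tangentSpace S (z : E)),
    B z ![(π.hamiltonianVectorField H z : E), (Y : E)] = 0) ∧
  ∃ πB : BivectorField S, IsGaugeTransformOf B π πB

/-- `br` is the bracket on `C^∞(S')` induced by `π` through the projection `P : S → S'`: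
`{f, g}_red ∘ P = {f ∘ P, g ∘ P}_π`. -/
def IsReducedBracket {S : Set E} {S' : Set E'} (P : E → E') (hP : ContDiff ℝ ∞ P)
    (hS : Set.MapsTo P S S') (π : BivectorField S)
    (br : SmoothFn S' → SmoothFn S' → SmoothFn S') : Prop :=
  ∀ (f g : SmoothFn S') (z : S),
    br f g ⟨P z, hS z.2⟩ = π.bracket (f.pullback P hP hS) (g.pullback P hP hS) z

/-- The bracket `br` on `C^∞(S)` is the restriction to `S` of the bracket `b` of functions on the
ambient space: `br f g = b F G` at every point of `S`, for all smooth functions `F`, `G`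
on an open set that extend `f`, `g` there. -/
def IsRestrictionOf {S : Set E} (b : (E → ℝ) → (E → ℝ) → E → ℝ)
    (br : SmoothFn S → SmoothFn S → SmoothFn S) : Prop :=
  ∀ (f g : SmoothFn S) (U : Set E) (F G : E → ℝ), IsOpen U → ContDiffOn ℝ ∞ F U →
    ContDiffOn ℝ ∞ G U → (∀ w : S, (w : E) ∈ U → f w = F w) →
    (∀ w : S, (w : E) ∈ U → g w = G w) →
    ∀ z : S, (z : E) ∈ U → br f g z = b F G z

end Embedded

/-! ## Rigid bodies with generalized rolling constraints -/

namespace Rolling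

open Embedded

/-- Column vectors; only the Euclidean dot product `⬝ᵥ` is used on them. -/
abbrev V3 : Type := Fin 3 → ℝ

/-- Real `3 × 3` matrices. -/
abbrev M3 : Type := Matrix (Fin 3) (Fin 3) ℝ

/-- The third canonical vector. -/
def e3 : V3 := ![0, 0, 1]

/-- The hat map `ℝ³ → 𝔰𝔬(3)`. -/
def hat (η : V3) : M3 := !![0, -η 2, η 1; η 2, 0, -η 0; -η 1, η 0, 0]

/-- The matrices that define a generalized rolling constraint. -/
def DefinesGeneralizedRolling (A : M3) : Prop :=
  (A.rank = 3 ∧ ∃ C ∈ Matrix.specialOrthogonalGroup (Fin 2) ℝ,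
    A = !![C 0 0, C 0 1, 0; C 1 0, C 1 1, 0; 0, 0, 1]) ∨
  (A.rank = 2 ∧ ∃ C ∈ Matrix.specialOrthogonalGroup (Fin 2) ℝ,
    A = !![C 0 0, C 0 1, 0; C 1 0, C 1 1, 0; 0, 0, 0]) ∨
  (A.rank = 1 ∧ A = Matrix.vecMulVec e3 e3) ∨
  (A.rank = 0 ∧ A = 0)

/-- The left Maurer–Cartan form of `SO(3)` with values in `ℝ³`: `λ_g (v)` is the vector whose hat
is (the skew-symmetric part of) `gᵀ v = g⁻¹ v`. The formula makes sense for all matrices `g`, `v`;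
on tangent vectors of `SO(3)` see `lam_hat`. -/
def lam (g : M3) : M3 →ₗ[ℝ] V3 where
  toFun v := ![((gᵀ * v) 2 1 - (gᵀ * v) 1 2) / 2, ((gᵀ * v) 0 2 - (gᵀ * v) 2 0) / 2,
    ((gᵀ * v) 1 0 - (gᵀ * v) 0 1) / 2]
  map_add' v w := by
    ext i; fin_cases i <;> simp [Matrix.mul_add] <;> ring
  map_smul' a v := by
    ext i; fin_cases i <;> simp <;> ring

theorem lam_hat (g : M3) (hg : g ∈ Matrix.specialOrthogonalGroup (Fin 3) ℝ) (η : V3) :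
    lam g (g * hat η) = η := by
  have h : gᵀ * g = 1 := by
    have := (Matrix.mem_specialOrthogonalGroup_iff.1 hg).1
    exact (Matrix.mem_orthogonalGroup_iff' (Fin 3) ℝ).1 this
  have h2 : gᵀ * (g * hat η) = hat η := by rw [← Matrix.mul_assoc, h, Matrix.one_mul]
  simp only [lam, LinearMap.coe_mk, AddHom.coe_mk, h2]
  ext i
  fin_cases i <;> simp [hat]

/-- The ambient space of `TQ` and of `T^*Q`, `Q = SO(3) × ℝ³`, in the left trivialization. A
tangent vector at `(g, x)` is `(g, x, Ω, ẋ)` with `Ω = λ(ġ)` the body angular velocity; the covector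
`M · λ + p · dx` at `(g, x)` is `(g, x, M, p)`. The matrix `g` is stored as the family of its
entries, which carries the usual topology. -/
abbrev Ambient : Type := (Fin 3 → Fin 3 → ℝ) × V3 × V3 × V3

/-- The matrix component `g` of a point, or `ġ` of a tangent vector. -/
def mat (z : Ambient) : M3 := Matrix.of z.1

theorem mat_add (v w : Ambient) : mat (v + w) = mat v + mat w := rfl

theorem mat_smul (a : ℝ) (v : Ambient) : mat (a • v) = a • mat v := rfl

/-- The Liouville 1-form `M · λ + p · dx` at `z = (g, x, M, p)`. -/
def liouville (z : Ambient) : Ambient →L[ℝ] ℝ :=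
  LinearMap.toContinuousLinearMap
    { toFun := fun v => z.2.2.1 ⬝ᵥ lam (mat z) (mat v) + z.2.2.2 ⬝ᵥ v.2.1
      map_add' := fun v w => by simp [mat_add, dotProduct_add]; ring
      map_smul' := fun a v => by simp [mat_smul, dotProduct_smul]; ring }

/-- The `i`-th component of the Maurer–Cartan form, as a 1-form on `T^*Q`. -/
def lamForm (i : Fin 3) (z : Ambient) : Ambient →L[ℝ] ℝ :=
  LinearMap.toContinuousLinearMap
    { toFun := fun v => lam (mat z) (mat v) i
      map_add' := fun v w => by simp [mat_add]
      map_smul' := fun a v => by simp [mat_smul] }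

/-- The canonical symplectic form `Ω_Q = -d(M · λ + p · dx)` of `T^*Q`. -/
def canonicalForm : TwoForm Ambient := fun z => - dOneForm liouville z

/-- The ambient space of the reduced space, with points `(γ, K)`. -/
abbrev RedAmbient : Type := V3 × V3

/-- The reduced space `S² × ℝ³`. -/
def reducedSpace : Set RedAmbient := {y | y.1 ⬝ᵥ y.1 = 1}

/-- The gradient `∂F/∂γ`. -/
def gradGamma (F : RedAmbient → ℝ) (y : RedAmbient) : V3 :=
  fun i => fderiv ℝ F y (Pi.single i 1, 0)

/-- The gradient `∂F/∂K`. -/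
def gradK (F : RedAmbient → ℝ) (y : RedAmbient) : V3 :=
  fun i => fderiv ℝ F y (0, Pi.single i 1)

/-- The symmetry group `H = {(h, y) ∈ SE(3) : h e₃ = e₃}`. -/
def symmetryGroup : Set (M3 × V3) :=
  {k | k.1 ∈ Matrix.specialOrthogonalGroup (Fin 3) ℝ ∧ k.1 *ᵥ e3 = e3}

/-- The cotangent lift to `T^*Q` of the action `(h, y) · (g, x) = (h g, h x + y)`. -/
def liftedAction (k : M3 × V3) (z : Ambient) : Ambient :=
  (Matrix.of.symm (k.1 * mat z), k.1 *ᵥ z.2.1 + k.2, z.2.2.1, k.1 *ᵥ z.2.2.2)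

/-- The data of a rolling rigid body: mass `m`, length scale `r`, principal moments of inertia
`I = (I₁, I₂, I₃)` and constraint matrix `A`. -/
structure Body where
  m : ℝ
  r : ℝ
  I : V3
  A : M3

namespace Body

variable (s : Body)

/-- The Lagrangian `½ 𝕀Ω · Ω + (m/2) ‖ẋ‖²` at `(g, x, Ω, ẋ)`, `𝕀 = diag I`. -/
def lagrangian (v : Ambient) : ℝ :=
  (1 / 2) * ((fun i => s.I i * v.2.2.1 i) ⬝ᵥ v.2.2.1) + (s.m / 2) * (v.2.2.2 ⬝ᵥ v.2.2.2)

/-- The Legendre transform `M = 𝕀Ω`, `p = m ẋ`. -/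
def legendre (v : Ambient) : Ambient :=
  (v.1, v.2.1, fun i => s.I i * v.2.2.1 i, s.m • v.2.2.2)

/-- The body angular velocity `Ω = 𝕀⁻¹ M` at `(g, x, M, p)`. -/
def angularVelocity (z : Ambient) : V3 := fun i => z.2.2.1 i / s.I i

/-- The inverse Legendre transform. -/
def legendreInv (z : Ambient) : Ambient :=
  (z.1, z.2.1, s.angularVelocity z, s.m⁻¹ • z.2.2.2)

/-- The constraint distribution `ẋ = r A g Ω`, as a subset of `TQ`. -/
def constraintVelocities : Set Ambient :=
  {v | mat v ∈ Matrix.specialOrthogonalGroup (Fin 3) ℝ ∧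
    v.2.2.2 = s.r • ((s.A * mat v) *ᵥ v.2.2.1)}

/-- The constraint submanifold of `T^*Q`, the image of the constraint distribution under the
Legendre transform. -/
def constraintManifold : Set Ambient := s.legendre '' s.constraintVelocities

/-- The Hamiltonian: the energy (equal to the Lagrangian, since there is no potential) composed
with the inverse Legendre transform. -/
def hamiltonian (z : Ambient) : ℝ := s.lagrangian (s.legendreInv z)

theorem contDiff_hamiltonian : ContDiff ℝ ∞ s.hamiltonian := by
  unfold hamiltonian lagrangian legendreInv angularVelocity dotProduct
  fun_prop

/-- The restriction of the Hamiltonian to the constraint manifold. -/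
def constrainedHamiltonian : SmoothFn s.constraintManifold :=
  SmoothFn.restrict _ s.hamiltonian s.contDiff_hamiltonian

/-- The constraint form `ε = dx - r A g λ`, pulled back to `T^*Q`. -/
def constraintForm (z : Ambient) : Ambient →ₗ[ℝ] V3 where
  toFun v := v.2.1 - s.r • ((s.A * mat z) *ᵥ lam (mat z) (mat v))
  map_add' v w := by simp [mat_add, Matrix.mulVec_add]; abel
  map_smul' a v := by simp [mat_smul, Matrix.mulVec_smul, smul_sub, smul_comm s.r a]

/-- The distribution `𝒞` of tangent vectors of the constraint manifold annihilated by `ε`. -/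
def distribution (z : s.constraintManifold) :
    Submodule ℝ (tangentSpace s.constraintManifold (z : Ambient)) :=
  (LinearMap.ker (s.constraintForm z)).comap
    (tangentSpace s.constraintManifold (z : Ambient)).subtype

/-- `π` is the nonholonomic bivector field, associated to `𝒞` and the restriction to `𝒞` of the
canonical symplectic form. -/
def IsNonholonomicBivector (π : BivectorField s.constraintManifold) : Prop :=
  IsAssociatedBivector s.distribution canonicalForm π

/-- The 2-form `B = -m r² Ω · dλ`. -/
def gaugeForm : TwoForm Ambient := fun z =>
  -(s.m * s.r ^ 2) • ∑ i, s.angularVelocity z i • dOneForm (lamForm i) z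

/-- The orbit projection `ρ = (γ, K)`, with `γ = g⁻¹ e₃` and
`K = M + r gᵀ Aᵀ p`, which is `𝕀Ω + m r² gᵀ Aᵀ A g Ω` on the constraint manifold. -/
def orbitProjection (z : Ambient) : RedAmbient :=
  ((mat z)ᵀ *ᵥ e3, z.2.2.1 + s.r • ((s.A * mat z)ᵀ *ᵥ z.2.2.2))

theorem contDiff_orbitProjection : ContDiff ℝ ∞ s.orbitProjection := by
  unfold orbitProjection
  refine ContDiff.prodMk ?_ ?_
  · refine contDiff_pi.2 fun i => ?_
    simp only [mat, Matrix.of_apply, Matrix.mulVec, dotProduct, Matrix.transpose_apply]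
    fun_prop
  · refine contDiff_pi.2 fun i => ?_
    simp only [mat, Matrix.of_apply, Matrix.mulVec, dotProduct, Matrix.transpose_apply, Pi.add_apply, Pi.smul_apply,
      Matrix.mul_apply]
    fun_prop

theorem mapsTo_orbitProjection :
    Set.MapsTo s.orbitProjection s.constraintManifold reducedSpace := by
  rintro _ ⟨v, ⟨hg, -⟩, rfl⟩
  have h : mat v * (mat v)ᵀ = 1 := by
    have := (Matrix.mem_specialOrthogonalGroup_iff.1 hg).1
    exact (Matrix.mem_orthogonalGroup_iff (Fin 3) ℝ).1 this
  change ((mat v)ᵀ *ᵥ e3) ⬝ᵥ ((mat v)ᵀ *ᵥ e3) = 1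
  rw [Matrix.dotProduct_mulVec, Matrix.vecMul_transpose, Matrix.mulVec_mulVec, h,
    Matrix.one_mulVec]
  simp [e3, dotProduct, Fin.sum_univ_three]

/-- The projection `ρ` presents `S² × ℝ³` as the orbit manifold of `H` acting on the constraint
manifold: `H` preserves the constraint manifold, `ρ` is a surjective submersion onto `S² × ℝ³`, and
its fibres are exactly the `H`-orbits. -/
def IsOrbitSpace : Prop :=
  (∀ k ∈ symmetryGroup, Set.MapsTo (liftedAction k) s.constraintManifold s.constraintManifold) ∧
  Set.SurjOn s.orbitProjection s.constraintManifold reducedSpace ∧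
  (∀ z ∈ s.constraintManifold, ∀ w ∈ tangentSpace reducedSpace (s.orbitProjection z),
    ∃ v ∈ tangentSpace s.constraintManifold z, fderiv ℝ s.orbitProjection z v = w) ∧
  (∀ z ∈ s.constraintManifold, ∀ z' ∈ s.constraintManifold,
    s.orbitProjection z = s.orbitProjection z' ↔ ∃ k ∈ symmetryGroup, z' = liftedAction k z)

/-- `br` is the reduction of the bracket of `π` by the group `H`. -/
def IsReduction (π : BivectorField s.constraintManifold)
    (br : SmoothFn reducedSpace → SmoothFn reducedSpace → SmoothFn reducedSpace) : Prop :=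
  IsReducedBracket s.orbitProjection s.contDiff_orbitProjection s.mapsTo_orbitProjection π br

/-- `m r²`. -/
def mr2 : ℝ := s.m * s.r ^ 2

/-- `𝕀⁻¹ v`. -/
def invI (v : V3) : V3 := fun i => v i / s.I i

/-- `(𝕀 + m r² E)⁻¹ v`. -/
def invJ (v : V3) : V3 := fun i => v i / (s.I i + s.mr2)

/-- The angular velocity `Ω` as a function of `y = (γ, K)`, for each rank `j` of `A`. -/
def omega (j : Fin 4) (y : RedAmbient) : V3 :=
  match j with
  | 0 => s.invI y.2
  | 1 => s.invI y.2 -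
      (s.mr2 * ((y.2 ⬝ᵥ s.invI y.1) / (y.1 ⬝ᵥ y.1 + s.mr2 * (y.1 ⬝ᵥ s.invI y.1)))) • s.invI y.1
  | 2 => s.invJ y.2 +
      (s.mr2 * ((y.2 ⬝ᵥ s.invJ y.1) / (y.1 ⬝ᵥ y.1 - s.mr2 * (y.1 ⬝ᵥ s.invJ y.1)))) • s.invJ y.1
  | 3 => s.invJ y.2

/-- The vector that multiplies `∂F/∂K × ∂G/∂K` in the bracket `{F, G}'` of rank `j`. -/
def bracketVector (j : Fin 4) (y : RedAmbient) : V3 :=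
  match j with
  | 0 => y.2 - s.mr2 • s.omega 0 y
  | 1 => y.2 - s.mr2 • s.omega 1 y + (s.mr2 * (s.omega 1 y ⬝ᵥ y.1)) • y.1
  | 2 => y.2 - (s.mr2 * (s.omega 2 y ⬝ᵥ y.1)) • y.1
  | 3 => y.2

/-- The bracket `{F, G}'` of rank `j` on functions of `y = (γ, K) ∈ ℝ³ × ℝ³`. -/
def primedBracket (j : Fin 4) (F G : RedAmbient → ℝ) (y : RedAmbient) : ℝ :=
  -(s.bracketVector j y ⬝ᵥ (gradK F y ⨯₃ gradK G y)) -
    y.1 ⬝ᵥ (gradK F y ⨯₃ gradGamma G y - gradK G y ⨯₃ gradGamma F y)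

end Body

end Rolling

end

/-! The constraint distribution 𝒞 has rank six, and `coordinates` trivializes it by η = λ(v)
together with κ, the velocity of K along v. That κ can be prescribed freely rests on K = LΩ with L =
𝕀 + mr²(Ag)ᵀAg positive definite (`inertiaMatrix_det_ne_zero`), which lets one solve for the angular
acceleration. In these coordinates the canonical form on 𝒞 is −(κ·η' − κ'·η − W·(η × η')) with W = M
+ 2r(Ag)ᵀp (`canonicalForm_apply`): the condition ε = 0 absorbs p·dx into K·λ, and the Maurer–Cartan
equation supplies the cross product. Since B is mr²Ω·(η × η') (`gaugeForm_apply`), subtracting it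
merely replaces W by W − mr²Ω.

A form of this shape is nondegenerate whatever W is, and its inverse is explicit
(`bivectorField_sharp`). So π_nh and its gauge transform are two instances of `bivectorField`. The
κ-derivative of the Hamiltonian is Ω, hence the η-component of X_H is Ω, and i_{X_H}B = mr²Ω·(Ω × ·)
= 0.

The projection ρ sends the vector with coordinates (η, κ) to (γ × η, κ), so the gauged bracket of
pull-backs already has the shape of {F, G}'. It remains to see that W − mr²Ω = W_j ∘ ρ
(`bracketVector_orbitProjection`). On the constraint manifold r(Ag)ᵀp = mr²gᵀAᵀAgΩ, and AᵀA is 0,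
e₃e₃ᵀ, E − e₃e₃ᵀ or E, so this vector depends only on γ and Ω. In turn Ω is recovered from (γ, K) by
a rank-one inversion formula (`omega_eq_of_gramVector`). The same recovery of Ω, together with the
fact that H commutes with A (`symmetry_commute`), identifies the fibres of ρ with the H-orbits. -/

noncomputable section

/-! ### Derivatives, tangent spaces, and uniqueness of associated bivector fields -/

namespace Embedded

variable {E : Type*} [NormedAddCommGroup E] [NormedSpace ℝ E]
variable {E' : Type*} [NormedAddCommGroup E'] [NormedSpace ℝ E']

/-- A derivative read off from a second-order expansion along the line `t ↦ z + t v`. -/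
theorem fderiv_eq_of_expansion {P : E → E'} {z v : E} {a b : E'} (hP : DifferentiableAt ℝ P z)
    (h : ∀ t : ℝ, P (z + t • v) = P z + t • a + t ^ 2 • b) : fderiv ℝ P z v = a := by
  have h1 : HasDerivAt (fun t : ℝ => P (z + t • v)) (fderiv ℝ P z v) 0 :=
    hP.hasFDerivAt.hasLineDerivAt v
  have h2 : HasDerivAt (fun t : ℝ => P z + t • a + t ^ 2 • b) a 0 := by
    have h3 := (((hasDerivAt_id (0 : ℝ)).smul_const a).const_add (P z)).add
      (((hasDerivAt_id (0 : ℝ)).pow 2).smul_const b)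
    exact h3.congr_deriv (by simp)
  rw [funext h] at h1
  exact h1.unique h2

/-- A smooth map that is constant on `S` has vanishing derivative on the tangent spaces of `S`. -/
theorem fderiv_eq_zero_of_constant {S : Set E} {P : E → E'} (hP : Differentiable ℝ P) {k : E'}
    (hS : ∀ z ∈ S, P z = k) {z v : E} (hv : v ∈ tangentSpace S z) : fderiv ℝ P z v = 0 := by
  induction hv using Submodule.span_induction with
  | mem v hv =>
    obtain ⟨c, hc, hcS, rfl, rfl⟩ := hv
    have h1 : HasDerivAt (P ∘ c) (fderiv ℝ P (c 0) (deriv c 0)) 0 :=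
      (hP (c 0)).hasFDerivAt.comp_hasDerivAt 0 ((hc.differentiable (by simp)) 0).hasDerivAt
    have h2 : P ∘ c = fun _ => k := funext fun t => hS _ (hcS t)
    rw [h2] at h1
    exact h1.unique (hasDerivAt_const _ _)
  | zero => simp
  | add x y _ _ hx hy => rw [map_add, hx, hy, add_zero]
  | smul a x _ hx => rw [map_smul, hx, smul_zero]

/-- The initial velocity of a curve in `S` of the form `z + t v + t² ψ(t)`. -/
theorem mem_tangentSpace_of_curve {S : Set E} {z v : E} {ψ : ℝ → E} (hψ : ContDiff ℝ ∞ ψ)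
    (h : ∀ t : ℝ, z + t • v + t ^ 2 • ψ t ∈ S) : v ∈ tangentSpace S z := by
  refine Submodule.subset_span ⟨fun t => z + t • v + t ^ 2 • ψ t, by fun_prop, h, by simp, ?_⟩
  have hd : HasDerivAt ψ (deriv ψ 0) 0 := ((hψ.differentiable (by simp)) 0).hasDerivAt
  have h3 := (((hasDerivAt_id (0 : ℝ)).smul_const v).const_add z).add
      (((hasDerivAt_id (0 : ℝ)).pow 2).smul hd)
  refine HasDerivAt.deriv (h3.congr_deriv ?_)
  simp

/-- The vectors extend to constant vector fields, which commute, so Cartan's formula has no bracket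
term. -/
theorem dOneForm_apply {θ : E → E →L[ℝ] ℝ} {z : E} (hθ : DifferentiableAt ℝ θ z) (v w : E) :
    dOneForm θ z ![v, w] =
      fderiv ℝ (fun y => θ y w) z v - fderiv ℝ (fun y => θ y v) z w := by
  have hd : DifferentiableAt ℝ
      (fun y => ContinuousAlternatingMap.ofSubsingleton ℝ E ℝ (0 : Fin 1) (θ y)) z :=
    ((ContinuousAlternatingMap.ofSubsingletonLIE (𝕜 := ℝ) (E := E) (F := ℝ)
      (0 : Fin 1)).differentiable _).comp z hθ
  rw [dOneForm, extDeriv_apply hd]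
  simp [Fin.sum_univ_two, Fin.removeNth, sub_eq_add_neg]

theorem update_pair_zero {α : Type*} (a b c : α) : Function.update ![a, b] 0 c = ![c, b] := by
  ext i; fin_cases i <;> rfl

theorem update_pair_one {α : Type*} (a b c : α) : Function.update ![a, b] 1 c = ![a, c] := by
  ext i; fin_cases i <;> rfl

theorem twoForm_neg_left (B : TwoForm E) (z X Y : E) : B z ![-X, Y] = - B z ![X, Y] := by
  have := (B z).toMultilinearMap.map_update_smul ![0, Y] 0 (-1) X
  simp only [update_pair_zero, neg_smul, one_smul] at this
  exact this

variable [FiniteDimensional ℝ E] {S : Set E}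

theorem BivectorField.ext_sharp {π π' : BivectorField S} (h : ∀ z α, π.sharp z α = π'.sharp z α) :
    π = π' := by
  have : π.toFun = π'.toFun := by
    funext z
    refine LinearMap.ext fun α => LinearMap.ext fun β => ?_
    rw [← π.apply_sharp, ← π'.apply_sharp, h]
  cases π
  cases π'
  simp_all

theorem BivectorField.sharp_eq_of_apply {π : BivectorField S} {z : S} {α : Cotangent S (z : E)}
    {X : tangentSpace S (z : E)} (h : ∀ β : Cotangent S (z : E), β X = π.toFun z α β) :
    π.sharp z α = X := by
  rw [← sub_eq_zero, ← Module.forall_dual_apply_eq_zero_iff ℝ]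
  intro β
  rw [map_sub, π.apply_sharp, h, sub_self]

/-- The right-hand side of the defining equivalence does not mention the bivector field, so it fixes
`sharp` pointwise, and `sharp` fixes the bivector field. -/
theorem IsAssociatedBivector.unique {F : ∀ z : S, Submodule ℝ (tangentSpace S (z : E))}
    {σ : TwoForm E} {π π' : BivectorField S} (h : IsAssociatedBivector F σ π)
    (h' : IsAssociatedBivector F σ π') : π = π' := by
  refine BivectorField.ext_sharp fun z α => ?_
  have h1 := (h' z α (-(π.sharp z α))).2 ((h z α _).1 (neg_neg _).symm)
  rw [h1, neg_neg]

theorem IsGaugeTransformOf.unique {B : TwoForm E} {π π₁ π₂ : BivectorField S}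
    (h₁ : IsGaugeTransformOf B π π₁) (h₂ : IsGaugeTransformOf B π π₂) : π₁ = π₂ := by
  refine BivectorField.ext_sharp fun z α => ?_
  have h : (π₁.sharp z α, α) ∈ π₂.graph z := by
    rw [h₂ z, ← h₁ z]
    rfl
  exact h

/-- The contraction `i_X B` of a 2-form with a tangent vector of `S`. -/
def contraction (B : TwoForm E) (z : S) (X : tangentSpace S (z : E)) : Cotangent S (z : E) where
  toFun Y := B z ![(X : E), (Y : E)]
  map_add' Y Y' := by
    have := (B z).toMultilinearMap.map_update_add ![(X : E), 0] 1 (Y : E) (Y' : E)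
    simp only [update_pair_one] at this
    exact this
  map_smul' a Y := by
    have := (B z).toMultilinearMap.map_update_smul ![(X : E), 0] 1 a (Y : E)
    simp only [update_pair_one] at this
    exact this

/-- If `π` and `π'` are associated to the same distribution and to the 2-forms `σ` and `σ - B`
on it, then `π'` is the gauge transformation of `π` by `B`. -/
theorem IsAssociatedBivector.isGaugeTransformOf
    {F : ∀ z : S, Submodule ℝ (tangentSpace S (z : E))} {σ B : TwoForm E}
    {π π' : BivectorField S} (h : IsAssociatedBivector F σ π)
    (h' : IsAssociatedBivector F (fun z => σ z - B z) π') : IsGaugeTransformOf B π π' := by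
  -- Moving i_X B across the equation (i_X(σ − B))|_F = β|_F turns it into the defining equation of
  -- `π` with covector β − i_X B.
  have key : ∀ (z : S) (X : tangentSpace S (z : E)) (β : Cotangent S (z : E)),
      π'.sharp z β = X ↔ π.sharp z (β - contraction B z X) = X := by
    intro z X β
    have e1 := h' z β (-X)
    have e2 := h z (β - contraction B z X) (-X)
    rw [neg_neg] at e1 e2
    rw [e1, e2]
    refine and_congr_right fun _ => forall₂_congr fun Y _ => ?_
    simp only [ContinuousAlternatingMap.sub_apply, Submodule.coe_neg, twoForm_neg_left,
      LinearMap.sub_apply]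
    change _ ↔ _ = β Y - B z ![(X : E), (Y : E)]
    constructor <;> intro h <;> linarith
  intro z
  ext ⟨X, β⟩
  constructor
  · intro hX
    refine ⟨β - contraction B z X, ((key z X β).1 (Eq.symm hX)).symm, fun Y => ?_⟩
    change β Y = β Y - B z ![(X : E), (Y : E)] + B z ![(X : E), (Y : E)]
    ring
  · rintro ⟨α, hα, hβ⟩
    have : β - contraction B z X = α := by
      refine LinearMap.ext fun Y => ?_
      have := hβ Y
      change β Y - B z ![(X : E), (Y : E)] = α Y
      simp only at this
      rw [this]
      ring
    exact ((key z X β).2 (this ▸ Eq.symm hα)).symm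

end Embedded

/-! ### Rotations, the Maurer–Cartan form and the exterior derivatives dλ, d(M·λ + p·dx) -/

namespace Rolling

open Embedded

abbrev SO3 : Submonoid M3 := Matrix.specialOrthogonalGroup (Fin 3) ℝ

theorem transpose_mul_self_of_mem {g : M3} (hg : g ∈ SO3) : gᵀ * g = 1 :=
  (Matrix.mem_orthogonalGroup_iff' (Fin 3) ℝ).1 (Matrix.mem_specialOrthogonalGroup_iff.1 hg).1

theorem mul_transpose_self_of_mem {g : M3} (hg : g ∈ SO3) : g * gᵀ = 1 :=
  (Matrix.mem_orthogonalGroup_iff (Fin 3) ℝ).1 (Matrix.mem_specialOrthogonalGroup_iff.1 hg).1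

theorem mem_SO3_iff {g : M3} : g ∈ SO3 ↔ g * gᵀ = 1 ∧ g.det = 1 := by
  rw [Matrix.mem_specialOrthogonalGroup_iff, Matrix.mem_orthogonalGroup_iff]

theorem hat_mulVec (η v : V3) : hat η *ᵥ v = η ⨯₃ v := by
  ext i
  fin_cases i <;> simp [hat, cross_apply, Matrix.mulVec, dotProduct, Fin.sum_univ_three] <;> ring

theorem hat_transpose (η : V3) : (hat η)ᵀ = -hat η := by
  ext i j
  fin_cases i <;> fin_cases j <;> simp [hat]

theorem cross_dot_right_comm (u v w : V3) : (u ⨯₃ v) ⬝ᵥ w = -(v ⬝ᵥ (u ⨯₃ w)) := by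
  simp [cross_apply, dotProduct, Fin.sum_univ_three]
  ring

theorem dot_cross_eq_cross_dot (u v w : V3) : u ⬝ᵥ (v ⨯₃ w) = (u ⨯₃ v) ⬝ᵥ w := by
  simp [cross_apply, dotProduct, Fin.sum_univ_three]
  ring

/-- Linearity in the base point is available because λ is extended to all matrices by a polynomial
formula; derivatives of λ then come from exact expansions. -/
theorem lam_add_left (g h v : M3) : lam (g + h) v = lam g v + lam h v := by
  ext i
  fin_cases i <;> simp [lam, Matrix.add_mul] <;> ring

theorem lam_smul_left (a : ℝ) (g v : M3) : lam (a • g) v = a • lam g v := by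
  ext i
  fin_cases i <;> simp [lam] <;> ring

/-- A velocity `v` at `g ∈ SO(3)` with `gᵀ v` skew-symmetric is `g` times the hat of `λ(v)`. -/
theorem eq_mul_hat_lam {g v : M3} (hg : g ∈ SO3) (h : vᵀ * g + gᵀ * v = 0) :
    v = g * hat (lam g v) := by
  have h1 : gᵀ * v = hat (lam g v) := by
    have h2 : ∀ i j, (gᵀ * v) j i + (gᵀ * v) i j = 0 := by
      intro i j
      have h3 := congrFun (congrFun h i) j
      have h4 : (vᵀ * g) = (gᵀ * v)ᵀ := by simp
      rw [h4] at h3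
      exact h3
    have := h2 0 0; have := h2 1 1; have := h2 2 2
    have := h2 0 1; have := h2 0 2; have := h2 1 2
    ext i j
    fin_cases i <;> fin_cases j <;> simp [hat, lam] <;> linarith
  rw [← h1, ← Matrix.mul_assoc, mul_transpose_self_of_mem hg, Matrix.one_mul]

/-- The Maurer–Cartan equation in algebraic form. -/
theorem lam_mul_hat_mul_hat {g : M3} (hg : g ∈ SO3) (η ξ : V3) :
    lam (g * hat η) (g * hat ξ) = -(1 / 2 : ℝ) • (η ⨯₃ ξ) := by
  have h : (g * hat η)ᵀ * (g * hat ξ) = -(hat η * hat ξ) := by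
    rw [Matrix.transpose_mul, hat_transpose, Matrix.mul_assoc, ← Matrix.mul_assoc gᵀ,
      transpose_mul_self_of_mem hg, Matrix.one_mul, Matrix.neg_mul]
  simp only [lam, LinearMap.coe_mk, AddHom.coe_mk, h]
  ext i
  fin_cases i <;>
    simp [hat, cross_apply] <;> ring

theorem contDiff_liouville : ContDiff ℝ ∞ liouville := by
  refine contDiff_clm_apply_iff.2 fun v => ?_
  change ContDiff ℝ ∞ fun z : Ambient => z.2.2.1 ⬝ᵥ lam (mat z) (mat v) + z.2.2.2 ⬝ᵥ v.2.1
  simp only [mat, lam, LinearMap.coe_mk, AddHom.coe_mk, dotProduct, Fin.sum_univ_three,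
    Matrix.mul_apply, Matrix.transpose_apply, Matrix.of_apply, Matrix.cons_val_zero,
    Matrix.cons_val_one, Matrix.cons_val]
  fun_prop

theorem contDiff_lamForm (i : Fin 3) : ContDiff ℝ ∞ (lamForm i) := by
  refine contDiff_clm_apply_iff.2 fun v => ?_
  change ContDiff ℝ ∞ fun z : Ambient => lam (mat z) (mat v) i
  simp only [mat, lam, LinearMap.coe_mk, AddHom.coe_mk, Fin.sum_univ_three,
    Matrix.mul_apply, Matrix.transpose_apply, Matrix.of_apply]
  fin_cases i <;> simp <;> fun_prop

theorem dOneForm_lamForm (i : Fin 3) (z v w : Ambient) :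
    dOneForm (lamForm i) z ![v, w] = lam (mat v) (mat w) i - lam (mat w) (mat v) i := by
  have hd := (contDiff_lamForm i).differentiable (by simp)
  have h : ∀ v w : Ambient, fderiv ℝ (fun y => lamForm i y w) z v = lam (mat v) (mat w) i := by
    intro v w
    refine fderiv_eq_of_expansion (b := 0) ((hd z).clm_apply (differentiableAt_const _))
      fun t => ?_
    change lam (mat (z + t • v)) (mat w) i = lam (mat z) (mat w) i + t • _ + _
    simp [mat_add, mat_smul, lam_add_left, lam_smul_left]
  rw [dOneForm_apply (hd z), h, h]

theorem dOneForm_liouville (z v w : Ambient) :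
    dOneForm liouville z ![v, w] =
      (v.2.2.1 ⬝ᵥ lam (mat z) (mat w) + z.2.2.1 ⬝ᵥ lam (mat v) (mat w) + v.2.2.2 ⬝ᵥ w.2.1) -
      (w.2.2.1 ⬝ᵥ lam (mat z) (mat v) + z.2.2.1 ⬝ᵥ lam (mat w) (mat v) + w.2.2.2 ⬝ᵥ v.2.1) := by
  have hd := contDiff_liouville.differentiable (by simp)
  have h : ∀ v w : Ambient, fderiv ℝ (fun y => liouville y w) z v =
      v.2.2.1 ⬝ᵥ lam (mat z) (mat w) + z.2.2.1 ⬝ᵥ lam (mat v) (mat w) + v.2.2.2 ⬝ᵥ w.2.1 := by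
    intro v w
    refine fderiv_eq_of_expansion (b := v.2.2.1 ⬝ᵥ lam (mat v) (mat w))
      ((hd z).clm_apply (differentiableAt_const _)) fun t => ?_
    change (z + t • v).2.2.1 ⬝ᵥ lam (mat (z + t • v)) (mat w) + (z + t • v).2.2.2 ⬝ᵥ w.2.1 =
      z.2.2.1 ⬝ᵥ lam (mat z) (mat w) + z.2.2.2 ⬝ᵥ w.2.1 + t • _ + _
    simp only [mat_add, mat_smul, lam_add_left, lam_smul_left, Prod.snd_add, Prod.fst_add,
      Prod.smul_snd, Prod.smul_fst, add_dotProduct, dotProduct_add, smul_dotProduct,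
      dotProduct_smul, smul_eq_mul]
    ring
  rw [dOneForm_apply (hd z), h, h]

/-! ### Curves in SO(3) by the Cayley transform -/

/-- The rotation obtained from `t η` by the Cayley transform. -/
def cayley (η : V3) (t : ℝ) : M3 :=
  1 + t • hat η + t ^ 2 • ((1 + t ^ 2 * (η ⬝ᵥ η) / 4)⁻¹ •
    ((1 / 2 : ℝ) • (hat η * hat η) - (t * (η ⬝ᵥ η) / 4) • hat η))

theorem cayley_denom_pos (η : V3) (t : ℝ) : 0 < 1 + t ^ 2 * (η ⬝ᵥ η) / 4 := by
  have : 0 ≤ η ⬝ᵥ η := by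
    simp only [dotProduct, Fin.sum_univ_three]
    nlinarith [mul_self_nonneg (η 0), mul_self_nonneg (η 1), mul_self_nonneg (η 2)]
  positivity

/-- With q the inverse of 1 + t²‖η‖²/4, the matrix is 1 + q(tη̂ + t²η̂²/2), the closed form of (1 −
tη̂/2)⁻¹(1 + tη̂/2). Orthogonality and determinant one are then polynomial identities modulo the
relation defining q. The definition separates the first-order part so that the curve fits
`mem_tangentSpace_of_curve`. -/
theorem cayley_mem (η : V3) (t : ℝ) : cayley η t ∈ SO3 := by
  have hp := (cayley_denom_pos η t).ne'
  simp only [dotProduct, Fin.sum_univ_three] at hp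
  rw [mem_SO3_iff]
  obtain ⟨q, hq⟩ : ∃ q, q = (1 + t ^ 2 * (η 0 * η 0 + η 1 * η 1 + η 2 * η 2) / 4)⁻¹ := ⟨_, rfl⟩
  have hq1 : q * (1 + t ^ 2 * (η 0 * η 0 + η 1 * η 1 + η 2 * η 2) / 4) = 1 := by
    rw [hq, inv_mul_cancel₀ hp]
  have hC : cayley η t = 1 + (q * t) • hat η + (q * t ^ 2 / 2) • (hat η * hat η) := by
    have h2 : t = q * t + t ^ 2 * (q * (t * (η 0 * η 0 + η 1 * η 1 + η 2 * η 2) / 4)) := by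
      linear_combination (-t) * hq1
    simp only [cayley, dotProduct, Fin.sum_univ_three, ← hq]
    ext i j
    simp only [Matrix.add_apply, Matrix.smul_apply, Matrix.sub_apply, smul_eq_mul]
    linear_combination (hat η i j) * h2
  rw [hC]
  constructor
  · ext i j
    fin_cases i <;> fin_cases j <;>
      simp [hat, Matrix.mul_apply, Fin.sum_univ_three, Matrix.one_apply] <;> grind
  · rw [Matrix.det_fin_three]
    simp [hat]
    grind

/-! ### Smoothness of matrix and vector operations -/

section MatrixSmoothness

variable {E : Type*} [NormedAddCommGroup E] [NormedSpace ℝ E]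

theorem contDiff_mul_apply {M N : E → M3} (hM : ∀ i j, ContDiff ℝ ∞ fun z => M z i j)
    (hN : ∀ i j, ContDiff ℝ ∞ fun z => N z i j) (i j : Fin 3) :
    ContDiff ℝ ∞ fun z => (M z * N z) i j := by
  simp only [Matrix.mul_apply]
  exact ContDiff.sum fun k _ => (hM i k).mul (hN k j)

theorem contDiff_mulVec {M : E → M3} {v : E → V3} (hM : ∀ i j, ContDiff ℝ ∞ fun z => M z i j)
    (hv : ContDiff ℝ ∞ v) : ContDiff ℝ ∞ fun z => M z *ᵥ v z := by
  refine contDiff_pi.2 fun i => ?_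
  simp only [Matrix.mulVec, dotProduct]
  exact ContDiff.sum fun k _ => (hM i k).mul (contDiff_pi.1 hv k)

theorem contDiffOn_dotProduct {u v : E → V3} {S : Set E} (hu : ContDiffOn ℝ ∞ u S)
    (hv : ContDiffOn ℝ ∞ v S) : ContDiffOn ℝ ∞ (fun z => u z ⬝ᵥ v z) S := by
  simp only [dotProduct]
  exact ContDiffOn.sum fun i _ => (contDiffOn_pi.1 hu i).mul (contDiffOn_pi.1 hv i)

theorem contDiffOn_cross {u v : E → V3} {S : Set E} (hu : ContDiffOn ℝ ∞ u S)
    (hv : ContDiffOn ℝ ∞ v S) : ContDiffOn ℝ ∞ (fun z => u z ⨯₃ v z) S := by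
  have hu' := contDiffOn_pi.1 hu
  have hv' := contDiffOn_pi.1 hv
  refine contDiffOn_pi.2 fun i => ?_
  simp only [cross_apply]
  fin_cases i
  · exact ((hu' 1).mul (hv' 2)).sub ((hu' 2).mul (hv' 1))
  · exact ((hu' 2).mul (hv' 0)).sub ((hu' 0).mul (hv' 2))
  · exact ((hu' 0).mul (hv' 1)).sub ((hu' 1).mul (hv' 0))

theorem contDiff_cross {u v : E → V3} (hu : ContDiff ℝ ∞ u) (hv : ContDiff ℝ ∞ v) :
    ContDiff ℝ ∞ fun z => u z ⨯₃ v z :=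
  contDiffOn_univ.1 (contDiffOn_cross hu.contDiffOn hv.contDiffOn)

theorem contDiff_inv_apply {M : E → M3} (hM : ∀ i j, ContDiff ℝ ∞ fun z => M z i j)
    (hdet : ∀ z, (M z).det ≠ 0) (i j : Fin 3) : ContDiff ℝ ∞ fun z => (M z)⁻¹ i j := by
  have hd : ContDiff ℝ ∞ fun z => (M z).det := by
    simp only [Matrix.det_fin_three]
    fun_prop
  have ha : ContDiff ℝ ∞ fun z => (M z).adjugate i j := by
    simp only [Matrix.adjugate_fin_three]
    fin_cases i <;> fin_cases j <;> simp <;> fun_prop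
  simp only [Matrix.inv_def, Ring.inverse_eq_inv', Matrix.smul_apply, smul_eq_mul]
  exact (hd.inv hdet).mul ha

end MatrixSmoothness

theorem contDiff_mat_apply (i j : Fin 3) : ContDiff ℝ ∞ fun z : Ambient => mat z i j := by
  simp only [mat, Matrix.of_apply]
  fun_prop

/-- The second-order remainder of the Cayley curve. -/
def cayleyRem (η : V3) (t : ℝ) : M3 :=
  (1 + t ^ 2 * (η ⬝ᵥ η) / 4)⁻¹ •
    ((1 / 2 : ℝ) • (hat η * hat η) - (t * (η ⬝ᵥ η) / 4) • hat η)

theorem cayley_eq (η : V3) (t : ℝ) : cayley η t = 1 + t • hat η + t ^ 2 • cayleyRem η t := rfl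

theorem contDiff_cayleyRem_apply (η : V3) (i j : Fin 3) :
    ContDiff ℝ ∞ fun t => cayleyRem η t i j := by
  simp only [cayleyRem, Matrix.smul_apply, Matrix.sub_apply, smul_eq_mul]
  refine ContDiff.mul (ContDiff.inv (by fun_prop) fun t => (cayley_denom_pos η t).ne') ?_
  fun_prop

/-! ### The constraint manifold and its tangent spaces -/

namespace Body

variable (s : Body)

/-- The matrix `(A g)ᵀ A g`. -/
def gramMatrix (z : Ambient) : M3 := (s.A * mat z)ᵀ * (s.A * mat z)

/-- The locked inertia matrix `L = 𝕀 + m r² (A g)ᵀ A g`, with `K = L Ω`. -/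
def inertiaMatrix (z : Ambient) : M3 := Matrix.diagonal s.I + s.mr2 • s.gramMatrix z

/-- The velocity of the component `K` of the orbit projection along `v`. -/
def momentumVelocity (z v : Ambient) : V3 :=
  v.2.2.1 + s.r • ((s.A * mat v)ᵀ *ᵥ z.2.2.2 + (s.A * mat z)ᵀ *ᵥ v.2.2.2)

theorem angularVelocity_add (v w : Ambient) :
    s.angularVelocity (v + w) = s.angularVelocity v + s.angularVelocity w := by
  ext i; simp [angularVelocity, add_div]

theorem angularVelocity_smul (a : ℝ) (v : Ambient) :
    s.angularVelocity (a • v) = a • s.angularVelocity v := by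
  ext i; simp [angularVelocity, mul_div_assoc]

theorem contDiff_angularVelocity : ContDiff ℝ ∞ s.angularVelocity := by
  unfold angularVelocity
  fun_prop

theorem contDiff_mul_mat_apply (i j : Fin 3) :
    ContDiff ℝ ∞ fun z : Ambient => (s.A * mat z) i j :=
  contDiff_mul_apply (M := fun _ => s.A) (fun _ _ => contDiff_const) contDiff_mat_apply i j

theorem contDiff_gramMatrix_apply (i j : Fin 3) :
    ContDiff ℝ ∞ fun z => s.gramMatrix z i j :=
  contDiff_mul_apply (fun i j => s.contDiff_mul_mat_apply j i) s.contDiff_mul_mat_apply i j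

theorem contDiff_inertiaMatrix_apply (i j : Fin 3) :
    ContDiff ℝ ∞ fun z => s.inertiaMatrix z i j := by
  simp only [inertiaMatrix, Matrix.add_apply, Matrix.smul_apply, smul_eq_mul]
  exact contDiff_const.add (contDiff_const.mul (s.contDiff_gramMatrix_apply i j))

theorem fderiv_orbitProjection (z v : Ambient) :
    fderiv ℝ s.orbitProjection z v = ((mat v)ᵀ *ᵥ e3, s.momentumVelocity z v) := by
  refine fderiv_eq_of_expansion (b := (0, s.r • ((s.A * mat v)ᵀ *ᵥ v.2.2.2)))
    (s.contDiff_orbitProjection.differentiable (by simp) z) fun t => ?_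
  ext1
  · simp [orbitProjection, mat_add, mat_smul, Matrix.add_mulVec, Matrix.smul_mulVec]
  · simp only [orbitProjection, mat_add, mat_smul, momentumVelocity, Matrix.mul_add,
      Matrix.mul_smul, Matrix.transpose_add, Matrix.transpose_smul, Matrix.add_mulVec,
      Matrix.smul_mulVec, Prod.snd_add, Prod.fst_add, Prod.smul_snd, Prod.smul_fst,
      Matrix.mulVec_add, Matrix.mulVec_smul]
    module

variable {s}

theorem momenta_eq (hI : ∀ i, 0 < s.I i) (z : Ambient) (i : Fin 3) :
    z.2.2.1 i = s.I i * s.angularVelocity z i := by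
  have := (hI i).ne'
  simp only [angularVelocity]
  field_simp

/-- Since 𝕀 is invertible, Ω can be read off from M, and the image of the Legendre transform is cut
out by equations that can be differentiated. -/
theorem mem_constraintManifold_iff (hI : ∀ i, 0 < s.I i) (z : Ambient) :
    z ∈ s.constraintManifold ↔ mat z ∈ SO3 ∧
      z.2.2.2 = (s.m * s.r) • ((s.A * mat z) *ᵥ s.angularVelocity z) := by
  constructor
  · rintro ⟨v, ⟨hg, hv⟩, rfl⟩
    have h : s.angularVelocity (s.legendre v) = v.2.2.1 := by
      ext i
      have := (hI i).ne'
      simp only [angularVelocity, legendre]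
      field_simp
    refine ⟨hg, ?_⟩
    rw [h]
    change s.m • v.2.2.2 = (s.m * s.r) • ((s.A * mat v) *ᵥ v.2.2.1)
    rw [hv, smul_smul]
  · rintro ⟨hg, hp⟩
    refine ⟨(z.1, z.2.1, s.angularVelocity z, s.r • ((s.A * mat z) *ᵥ s.angularVelocity z)),
      ⟨hg, rfl⟩, ?_⟩
    refine Prod.ext rfl (Prod.ext rfl (Prod.ext ?_ ?_))
    · exact funext fun i => (momenta_eq hI z i).symm
    · rw [hp, mul_smul]
      rfl

/-- The tangent spaces of the constraint manifold. -/
theorem mem_tangentSpace_iff (hI : ∀ i, 0 < s.I i) {z : Ambient} (hz : z ∈ s.constraintManifold)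
    (v : Ambient) : v ∈ tangentSpace s.constraintManifold z ↔
      mat v = mat z * hat (lam (mat z) (mat v)) ∧
      v.2.2.2 = (s.m * s.r) • ((s.A * mat v) *ᵥ s.angularVelocity z +
        (s.A * mat z) *ᵥ s.angularVelocity v) := by
  have hz' := (mem_constraintManifold_iff hI z).1 hz
  constructor
  · intro hv
    constructor
    · refine eq_mul_hat_lam hz'.1 ?_
      -- gᵀg is constant on the constraint manifold; its derivative says that gᵀv is skew-symmetric.
      have hP : ContDiff ℝ ∞ fun z : Ambient => Matrix.of.symm ((mat z)ᵀ * mat z) := by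
        refine contDiff_pi.2 fun i => contDiff_pi.2 fun j => ?_
        exact contDiff_mul_apply (fun i j => contDiff_mat_apply j i) contDiff_mat_apply i j
      have h1 := fderiv_eq_zero_of_constant (hP.differentiable (by simp))
        (k := Matrix.of.symm 1) (fun w hw => congrArg Matrix.of.symm
          (transpose_mul_self_of_mem ((mem_constraintManifold_iff hI w).1 hw).1)) hv
      rw [fderiv_eq_of_expansion
        (a := Matrix.of.symm ((mat v)ᵀ * mat z + (mat z)ᵀ * mat v))
        (b := Matrix.of.symm ((mat v)ᵀ * mat v)) (hP.differentiable (by simp) z)] at h1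
      · exact h1
      · intro t
        change (mat (z + t • v))ᵀ * mat (z + t • v) = (mat z)ᵀ * mat z +
          t • ((mat v)ᵀ * mat z + (mat z)ᵀ * mat v) + t ^ 2 • ((mat v)ᵀ * mat v)
        simp only [mat_add, mat_smul, Matrix.transpose_add, Matrix.transpose_smul,
          Matrix.add_mul, Matrix.mul_add, Matrix.smul_mul, Matrix.mul_smul]
        module
    · have hP : ContDiff ℝ ∞ fun z : Ambient =>
          z.2.2.2 - (s.m * s.r) • ((s.A * mat z) *ᵥ s.angularVelocity z) :=
        ContDiff.sub (by fun_prop) ((contDiff_mulVec s.contDiff_mul_mat_apply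
          s.contDiff_angularVelocity).const_smul _)
      have h1 := fderiv_eq_zero_of_constant (hP.differentiable (by simp))
        (k := 0) (fun w hw => sub_eq_zero.2 ((mem_constraintManifold_iff hI w).1 hw).2) hv
      rw [fderiv_eq_of_expansion
        (a := v.2.2.2 - (s.m * s.r) • ((s.A * mat v) *ᵥ s.angularVelocity z +
          (s.A * mat z) *ᵥ s.angularVelocity v))
        (b := -((s.m * s.r) • ((s.A * mat v) *ᵥ s.angularVelocity v)))
        (hP.differentiable (by simp) z)] at h1
      · exact sub_eq_zero.1 h1
      · intro t
        simp only [mat_add, mat_smul, angularVelocity_add, angularVelocity_smul, Matrix.mul_add,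
          Matrix.mul_smul, Matrix.add_mulVec, Matrix.mulVec_add, Matrix.smul_mulVec,
          Matrix.mulVec_smul, Prod.snd_add, Prod.smul_snd]
        module
  · rintro ⟨hv1, hv2⟩
    obtain ⟨η, hη⟩ : ∃ η, η = lam (mat z) (mat v) := ⟨_, rfl⟩
    rw [← hη] at hv1
    -- The curve follows the Cayley rotation in g and straight lines in x and M. The remainder in p
    -- is forced by the constraint, which holds to all orders in t.
    let R := cayleyRem η
    let ψ : ℝ → Ambient := fun t => (Matrix.of.symm (mat z * R t), 0, 0,
      (s.m * s.r) • ((s.A * mat v) *ᵥ s.angularVelocity v +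
        (s.A * (mat z * R t)) *ᵥ (s.angularVelocity z + t • s.angularVelocity v)))
    have hR : ∀ i j, ContDiff ℝ ∞ fun t => (mat z * R t) i j :=
      contDiff_mul_apply (fun _ _ => contDiff_const) (contDiff_cayleyRem_apply η)
    have hψ : ContDiff ℝ ∞ ψ := by
      refine ContDiff.prodMk (contDiff_pi.2 fun i => contDiff_pi.2 fun j => hR i j)
        (contDiff_const.prodMk (contDiff_const.prodMk (ContDiff.const_smul _
          (contDiff_const.add (contDiff_mulVec
            (contDiff_mul_apply (fun _ _ => contDiff_const) hR) ?_)))))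
      fun_prop
    refine mem_tangentSpace_of_curve hψ fun t => ?_
    have hmat : mat (z + t • v + t ^ 2 • ψ t) = mat z * cayley η t := by
      rw [cayley_eq, mat_add, mat_add, mat_smul, mat_smul, hv1]
      change _ + _ + t ^ 2 • (mat z * R t) = _
      simp only [Matrix.mul_add, Matrix.mul_smul, Matrix.mul_one, R]
    have hψ1 : mat (ψ t) = mat z * R t := rfl
    have hψ2 : s.angularVelocity (ψ t) = 0 := by
      ext i
      simp [angularVelocity, ψ]
    refine (mem_constraintManifold_iff hI _).2 ⟨?_, ?_⟩
    · rw [hmat]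
      exact mul_mem hz'.1 (cayley_mem η t)
    · have hl : (z + t • v + t ^ 2 • ψ t).2.2.2 = z.2.2.2 + t • v.2.2.2 + t ^ 2 • (ψ t).2.2.2 :=
        rfl
      have hψ3 : (ψ t).2.2.2 = (s.m * s.r) • ((s.A * mat v) *ᵥ s.angularVelocity v +
        (s.A * (mat z * R t)) *ᵥ (s.angularVelocity z + t • s.angularVelocity v)) := rfl
      rw [hl, hz'.2, hv2, hψ3]
      simp only [mat_add, mat_smul, angularVelocity_add, angularVelocity_smul, hψ1, hψ2,
        Matrix.mul_add, Matrix.mul_smul, Matrix.add_mulVec, Matrix.mulVec_add,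
        Matrix.smul_mulVec, Matrix.mulVec_smul, smul_zero, add_zero]
      module

end Body

/-! ### Coordinates (η, κ) on the constraint distribution, and the two 2-forms in them -/

namespace Body

variable {s : Body}

theorem inertiaMatrix_mulVec (z : Ambient) (v : V3) :
    s.inertiaMatrix z *ᵥ v = (fun i => s.I i * v i) + s.mr2 • (s.gramMatrix z *ᵥ v) := by
  rw [inertiaMatrix, Matrix.add_mulVec, Matrix.smul_mulVec]
  congr 1
  ext i
  rw [Matrix.mulVec_diagonal]

/-- A positive definite diagonal matrix plus a nonnegative multiple of a Gram matrix is positive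
definite. This needs no orthogonality of g, so `frame` is smooth on the whole ambient space. -/
theorem inertiaMatrix_det_ne_zero (hm : 0 < s.m) (hI : ∀ i, 0 < s.I i) (z : Ambient) :
    (s.inertiaMatrix z).det ≠ 0 := by
  intro h
  obtain ⟨v, hv, h0⟩ := Matrix.exists_mulVec_eq_zero_iff.2 h
  apply hv
  have h1 : v ⬝ᵥ (s.inertiaMatrix z *ᵥ v) = 0 := by rw [h0, dotProduct_zero]
  have h2 : 0 ≤ v ⬝ᵥ (s.gramMatrix z *ᵥ v) := by
    rw [gramMatrix, ← Matrix.mulVec_mulVec, Matrix.mulVec_transpose, dotProduct_comm,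
      ← Matrix.dotProduct_mulVec]
    simp only [dotProduct, Fin.sum_univ_three]
    exact add_nonneg (add_nonneg (mul_self_nonneg _) (mul_self_nonneg _)) (mul_self_nonneg _)
  have h3 : 0 ≤ s.mr2 * (v ⬝ᵥ (s.gramMatrix z *ᵥ v)) :=
    mul_nonneg (mul_nonneg hm.le (sq_nonneg _)) h2
  rw [inertiaMatrix_mulVec, dotProduct_add, dotProduct_smul, smul_eq_mul] at h1
  have h4 : v ⬝ᵥ (fun i => s.I i * v i) = ∑ i, s.I i * v i ^ 2 :=
    Finset.sum_congr rfl fun i _ => by ring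
  have h5 : ∀ i ∈ Finset.univ, 0 ≤ s.I i * v i ^ 2 := fun i _ =>
    mul_nonneg (hI i).le (sq_nonneg _)
  have h6 : ∑ i, s.I i * v i ^ 2 = 0 :=
    le_antisymm (by linarith) (Finset.sum_nonneg h5)
  ext i
  have h7 := (Finset.sum_eq_zero_iff_of_nonneg h5).1 h6 i (Finset.mem_univ i)
  simpa [(hI i).ne'] using h7

theorem inertiaMatrix_mulVec_eq_iff (hm : 0 < s.m) (hI : ∀ i, 0 < s.I i) (z : Ambient)
    (u v : V3) : s.inertiaMatrix z *ᵥ u = v ↔ u = (s.inertiaMatrix z)⁻¹ *ᵥ v := by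
  have hu : IsUnit (s.inertiaMatrix z).det := (inertiaMatrix_det_ne_zero hm hI z).isUnit
  constructor
  · rintro rfl
    rw [Matrix.mulVec_mulVec, Matrix.nonsing_inv_mul _ hu, Matrix.one_mulVec]
  · rintro rfl
    rw [Matrix.mulVec_mulVec, Matrix.mul_nonsing_inv _ hu, Matrix.one_mulVec]

variable (s)

/-- The difference `K - M`, as a function on the cotangent bundle. -/
def rollingMomentum (z : Ambient) : V3 := s.r • ((s.A * mat z)ᵀ *ᵥ z.2.2.2)

theorem contDiff_rollingMomentum : ContDiff ℝ ∞ s.rollingMomentum :=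
  (contDiff_mulVec (fun i j => s.contDiff_mul_mat_apply j i)
    (contDiff_snd.comp (contDiff_snd.comp contDiff_snd))).const_smul _

variable {s}

theorem transpose_mul_hat_mulVec (g : M3) (η v : V3) :
    (s.A * (g * hat η))ᵀ *ᵥ v = -(η ⨯₃ ((s.A * g)ᵀ *ᵥ v)) := by
  rw [← Matrix.mul_assoc, Matrix.transpose_mul, hat_transpose, ← Matrix.mulVec_mulVec,
    Matrix.neg_mulVec, hat_mulVec]

/-- Differentiating K = M + r(Ag)ᵀp under the linearized constraint isolates the angular
acceleration, multiplied by the inertia matrix. `frameAcceleration` is the solution of this linear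
equation. -/
theorem momentumVelocity_eq (hI : ∀ i, 0 < s.I i) {z v : Ambient} {η : V3}
    (h1 : mat v = mat z * hat η)
    (h2 : v.2.2.2 = (s.m * s.r) • ((s.A * mat v) *ᵥ s.angularVelocity z +
        (s.A * mat z) *ᵥ s.angularVelocity v)) :
    s.momentumVelocity z v = s.inertiaMatrix z *ᵥ s.angularVelocity v +
      s.mr2 • (s.gramMatrix z *ᵥ (η ⨯₃ s.angularVelocity z)) - η ⨯₃ s.rollingMomentum z := by
  have h3 : v.2.2.1 = fun i => s.I i * s.angularVelocity v i := funext (momenta_eq hI v)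
  have h4 : (s.A * mat v) *ᵥ s.angularVelocity z =
      (s.A * mat z) *ᵥ (η ⨯₃ s.angularVelocity z) := by
    rw [h1, ← Matrix.mul_assoc, ← Matrix.mulVec_mulVec, hat_mulVec]
  rw [momentumVelocity, h2, h4, h1, transpose_mul_hat_mulVec, inertiaMatrix_mulVec, ← h3,
    rollingMomentum]
  simp only [gramMatrix, ← Matrix.mulVec_mulVec, mr2, Matrix.mulVec_smul, Matrix.mulVec_add,
    map_smul]
  module

variable (s)

/-- The angular acceleration of the vector of the constraint distribution with coordinates
`(η, κ)`. -/
def frameAcceleration (z : Ambient) (η κ : V3) : V3 :=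
  (s.inertiaMatrix z)⁻¹ *ᵥ (κ - s.mr2 • (s.gramMatrix z *ᵥ (η ⨯₃ s.angularVelocity z)) +
    η ⨯₃ s.rollingMomentum z)

/-- The vector of the constraint distribution with body angular velocity `η` along which `K` has
velocity `κ`. -/
def frame (z : Ambient) (η κ : V3) : Ambient :=
  (Matrix.of.symm (mat z * hat η), s.r • ((s.A * mat z) *ᵥ η),
    fun i => s.I i * s.frameAcceleration z η κ i,
    (s.m * s.r) • ((s.A * (mat z * hat η)) *ᵥ s.angularVelocity z +
      (s.A * mat z) *ᵥ s.frameAcceleration z η κ))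

variable {s}

theorem mat_frame (z : Ambient) (η κ : V3) : mat (s.frame z η κ) = mat z * hat η := rfl

theorem contDiff_frame (hm : 0 < s.m) (hI : ∀ i, 0 < s.I i) (η κ : V3) :
    ContDiff ℝ ∞ fun z => s.frame z η κ := by
  have h1 : ∀ i j, ContDiff ℝ ∞ fun z => (mat z * hat η) i j :=
    contDiff_mul_apply (N := fun _ => hat η) contDiff_mat_apply fun _ _ => contDiff_const
  have h2 : ContDiff ℝ ∞ fun z => s.frameAcceleration z η κ := by
    refine contDiff_mulVec (contDiff_inv_apply s.contDiff_inertiaMatrix_apply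
      (inertiaMatrix_det_ne_zero hm hI)) (ContDiff.add (contDiff_const.sub ?_) ?_)
    · exact (contDiff_mulVec s.contDiff_gramMatrix_apply
        (contDiff_cross contDiff_const s.contDiff_angularVelocity)).const_smul _
    · exact contDiff_cross contDiff_const s.contDiff_rollingMomentum
  refine ContDiff.prodMk (contDiff_pi.2 fun i => contDiff_pi.2 fun j => h1 i j)
    (ContDiff.prodMk ?_ (ContDiff.prodMk ?_ (ContDiff.const_smul _ (ContDiff.add ?_ ?_))))
  · exact (contDiff_mulVec s.contDiff_mul_mat_apply contDiff_const).const_smul _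
  · exact contDiff_pi.2 fun i => contDiff_const.mul (contDiff_pi.1 h2 i)
  · exact contDiff_mulVec (contDiff_mul_apply (M := fun _ => s.A) (fun _ _ => contDiff_const) h1)
      s.contDiff_angularVelocity
  · exact contDiff_mulVec s.contDiff_mul_mat_apply h2

theorem angularVelocity_frame (hI : ∀ i, 0 < s.I i) (z : Ambient) (η κ : V3) :
    s.angularVelocity (s.frame z η κ) = s.frameAcceleration z η κ := by
  ext i
  have := (hI i).ne'
  simp only [angularVelocity, frame]
  field_simp

theorem momentumVelocity_frame (hm : 0 < s.m) (hI : ∀ i, 0 < s.I i) (z : Ambient) (η κ : V3) :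
    s.momentumVelocity z (s.frame z η κ) = κ := by
  rw [momentumVelocity_eq hI (mat_frame z η κ) (by rw [angularVelocity_frame hI]; rfl),
    angularVelocity_frame hI,
    (inertiaMatrix_mulVec_eq_iff hm hI z _ _).2 (rfl : s.frameAcceleration z η κ = _)]
  abel

theorem lam_frame {z : Ambient} (hz : mat z ∈ SO3) (η κ : V3) :
    lam (mat z) (mat (s.frame z η κ)) = η :=
  lam_hat _ hz η

theorem frame_mem_tangentSpace (hI : ∀ i, 0 < s.I i) {z : Ambient}
    (hz : z ∈ s.constraintManifold) (η κ : V3) :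
    s.frame z η κ ∈ tangentSpace s.constraintManifold z := by
  rw [mem_tangentSpace_iff hI hz, lam_frame ((mem_constraintManifold_iff hI z).1 hz).1,
    angularVelocity_frame hI]
  exact ⟨rfl, rfl⟩

theorem mem_distribution_iff (z : s.constraintManifold)
    (v : tangentSpace s.constraintManifold (z : Ambient)) :
    v ∈ s.distribution z ↔
      (v : Ambient).2.1 = s.r • ((s.A * mat z) *ᵥ lam (mat z) (mat v)) :=
  sub_eq_zero

/-- In 𝒞 the pair (η, κ) determines everything: η gives ġ, the form ε gives ẋ, κ gives the angular
acceleration and with it Ṁ, and tangency gives ṗ. -/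
theorem frame_lam_momentumVelocity (hm : 0 < s.m) (hI : ∀ i, 0 < s.I i)
    {z : s.constraintManifold} {v : tangentSpace s.constraintManifold (z : Ambient)}
    (hv : v ∈ s.distribution z) :
    s.frame z (lam (mat z) (mat v)) (s.momentumVelocity z v) = v := by
  have hu := (mem_distribution_iff z v).1 hv
  obtain ⟨h1, h2⟩ := (mem_tangentSpace_iff hI z.2 v).1 v.2
  have h3 : s.angularVelocity v =
      s.frameAcceleration z (lam (mat z) (mat v)) (s.momentumVelocity z v) := by
    refine (inertiaMatrix_mulVec_eq_iff hm hI _ _ _).1 ?_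
    rw [momentumVelocity_eq hI h1 h2]
    abel
  refine Prod.ext ?_ (Prod.ext hu.symm (Prod.ext ?_ ?_))
  · exact congrArg Matrix.of.symm h1.symm
  · change (fun i => s.I i * s.frameAcceleration _ _ _ i) = (v : Ambient).2.2.1
    rw [← h3]
    exact funext fun i => (momenta_eq hI _ i).symm
  · change (s.m * s.r) • (_ + _ *ᵥ s.frameAcceleration _ _ _) = (v : Ambient).2.2.2
    rw [← h3, h2, ← h1]

theorem momentumVelocity_add (z v w : Ambient) :
    s.momentumVelocity z (v + w) = s.momentumVelocity z v + s.momentumVelocity z w := by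
  simp only [momentumVelocity, mat_add, Matrix.mul_add, Matrix.transpose_add, Matrix.add_mulVec,
    Prod.snd_add, Prod.fst_add, Matrix.mulVec_add]
  module

theorem momentumVelocity_smul (a : ℝ) (z v : Ambient) :
    s.momentumVelocity z (a • v) = a • s.momentumVelocity z v := by
  simp only [momentumVelocity, mat_smul, Matrix.mul_smul, Matrix.transpose_smul,
    Matrix.smul_mulVec, Prod.smul_snd, Prod.smul_fst, Matrix.mulVec_smul]
  module

/-- The coordinates `(η, κ)` on the constraint distribution. -/
def coordinates (hm : 0 < s.m) (hI : ∀ i, 0 < s.I i) (z : s.constraintManifold) :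
    s.distribution z ≃ₗ[ℝ] V3 × V3 where
  toFun v := (lam (mat z) (mat v.1), s.momentumVelocity z v.1)
  map_add' v w := by
    refine Prod.ext ?_ (momentumVelocity_add _ _ _)
    exact map_add (lam (mat z)) (mat v.1) (mat w.1)
  map_smul' a v := by
    refine Prod.ext ?_ (momentumVelocity_smul _ _ _)
    exact map_smul (lam (mat z)) a (mat v.1)
  invFun x := ⟨⟨s.frame z x.1 x.2, frame_mem_tangentSpace hI z.2 x.1 x.2⟩, by
    rw [mem_distribution_iff, lam_frame ((mem_constraintManifold_iff hI _).1 z.2).1]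
    rfl⟩
  left_inv v := Subtype.ext (Subtype.ext (frame_lam_momentumVelocity hm hI v.2))
  right_inv x := Prod.ext (lam_frame ((mem_constraintManifold_iff hI _).1 z.2).1 _ _)
    (momentumVelocity_frame hm hI _ _ _)

/-- The canonical symplectic form on the constraint distribution. -/
theorem canonicalForm_apply (hI : ∀ i, 0 < s.I i) (z : s.constraintManifold)
    {v w : tangentSpace s.constraintManifold (z : Ambient)} (hv : v ∈ s.distribution z)
    (hw : w ∈ s.distribution z) :
    canonicalForm z ![(v : Ambient), (w : Ambient)] =
      -(s.momentumVelocity z v ⬝ᵥ lam (mat z) (mat w) -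
        s.momentumVelocity z w ⬝ᵥ lam (mat z) (mat v) -
        ((z : Ambient).2.2.1 + (2 : ℝ) • s.rollingMomentum z) ⬝ᵥ
          (lam (mat z) (mat v) ⨯₃ lam (mat z) (mat w))) := by
  have hg := ((mem_constraintManifold_iff hI _).1 z.2).1
  -- One half of d(M·λ + p·dx)(v, w). Here dx(w) = rAgλ(w) turns ṗ·dx into part of the velocity of
  -- K, up to a term from ġ; antisymmetrization doubles the cross-product term and produces M +
  -- 2r(Ag)ᵀp.
  have key : ∀ {v w : tangentSpace s.constraintManifold (z : Ambient)}, v ∈ s.distribution z →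
      w ∈ s.distribution z →
      (v : Ambient).2.2.1 ⬝ᵥ lam (mat z) (mat w) + (z : Ambient).2.2.1 ⬝ᵥ lam (mat v) (mat w) +
        (v : Ambient).2.2.2 ⬝ᵥ (w : Ambient).2.1 =
      s.momentumVelocity z v ⬝ᵥ lam (mat z) (mat w) -
        ((1 / 2 : ℝ) • (z : Ambient).2.2.1 + s.rollingMomentum z) ⬝ᵥ
          (lam (mat z) (mat v) ⨯₃ lam (mat z) (mat w)) := by
    intro v w _ hw
    have hu := (mem_distribution_iff z w).1 hw
    have h1 := ((mem_tangentSpace_iff hI z.2 v).1 v.2).1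
    have h2 := ((mem_tangentSpace_iff hI z.2 w).1 w.2).1
    obtain ⟨η, hη⟩ : ∃ η, lam (mat z) (mat v) = η := ⟨_, rfl⟩
    obtain ⟨ξ, hξ⟩ : ∃ ξ, lam (mat z) (mat w) = ξ := ⟨_, rfl⟩
    rw [hη] at h1
    rw [hξ] at h2 hu
    have h3 : lam (mat v) (mat w) = -(1 / 2 : ℝ) • (η ⨯₃ ξ) := by
      rw [h1, h2, lam_mul_hat_mul_hat hg]
    have h4 : (v : Ambient).2.2.2 ⬝ᵥ (s.A * mat z) *ᵥ ξ =
        ((s.A * mat z)ᵀ *ᵥ (v : Ambient).2.2.2) ⬝ᵥ ξ := by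
      rw [Matrix.dotProduct_mulVec, Matrix.mulVec_transpose]
    rw [hη, hξ, h3, hu, momentumVelocity, h1, transpose_mul_hat_mulVec, rollingMomentum]
    simp only [add_dotProduct, smul_dotProduct, dotProduct_smul, neg_dotProduct, smul_eq_mul,
      cross_dot_right_comm, h4]
    ring
  have h5 : ∀ η ξ u : V3, u ⬝ᵥ (ξ ⨯₃ η) = -(u ⬝ᵥ (η ⨯₃ ξ)) := by
    intro η ξ u
    rw [← cross_anticomm, dotProduct_neg]
  change -(dOneForm liouville z ![(v : Ambient), (w : Ambient)]) = _
  rw [dOneForm_liouville, key hv hw, key hw hv, h5 (lam (mat z) (mat v))]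
  simp only [add_dotProduct, smul_dotProduct, smul_eq_mul]
  ring

/-- The 2-form `B` on the tangent spaces of the constraint manifold. -/
theorem gaugeForm_apply (hI : ∀ i, 0 < s.I i) (z : s.constraintManifold)
    (v w : tangentSpace s.constraintManifold (z : Ambient)) :
    s.gaugeForm z ![(v : Ambient), (w : Ambient)] =
      (s.mr2 • s.angularVelocity z) ⬝ᵥ (lam (mat z) (mat v) ⨯₃ lam (mat z) (mat w)) := by
  have hg := ((mem_constraintManifold_iff hI _).1 z.2).1
  have h1 := ((mem_tangentSpace_iff hI z.2 v).1 v.2).1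
  have h2 := ((mem_tangentSpace_iff hI z.2 w).1 w.2).1
  obtain ⟨η, hη⟩ : ∃ η, lam (mat z) (mat v) = η := ⟨_, rfl⟩
  obtain ⟨ξ, hξ⟩ : ∃ ξ, lam (mat z) (mat w) = ξ := ⟨_, rfl⟩
  rw [hη] at h1
  rw [hξ] at h2
  -- The Maurer–Cartan equation dλ = −λ × λ; its sign cancels the one in the definition of B.
  have h3 : ∀ i, dOneForm (lamForm i) z ![(v : Ambient), (w : Ambient)] = -(η ⨯₃ ξ) i := by
    intro i
    rw [dOneForm_lamForm, h1, h2, lam_mul_hat_mul_hat hg, lam_mul_hat_mul_hat hg,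
      ← cross_anticomm η ξ]
    simp only [Pi.smul_apply, Pi.neg_apply, smul_eq_mul]
    ring
  rw [hη, hξ]
  simp only [gaugeForm, ContinuousAlternatingMap.smul_apply, ContinuousAlternatingMap.sum_apply,
    h3, smul_eq_mul, smul_dotProduct, mr2]
  simp only [dotProduct, Fin.sum_univ_three]
  ring

end Body

/-! ### Bivector fields on the constraint manifold determined by a vector-valued function -/

theorem dual_apply_prod (f : V3 × V3 →ₗ[ℝ] ℝ) (x : V3 × V3) :
    f x = (fun i => f (Pi.single i 1, 0)) ⬝ᵥ x.1 + (fun i => f (0, Pi.single i 1)) ⬝ᵥ x.2 := by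
  have h1 : ∀ g : V3 →ₗ[ℝ] ℝ, ∀ u, g u = (fun i => g (Pi.single i 1)) ⬝ᵥ u := by
    intro g u
    conv_lhs => rw [pi_eq_sum_univ' u]
    simp [dotProduct, mul_comm]
  have h2 : x = LinearMap.inl ℝ V3 V3 x.1 + LinearMap.inr ℝ V3 V3 x.2 := by ext <;> simp
  conv_lhs => rw [h2]
  rw [map_add]
  exact congrArg₂ (· + ·) (h1 (f ∘ₗ LinearMap.inl ℝ V3 V3) x.1)
    (h1 (f ∘ₗ LinearMap.inr ℝ V3 V3) x.2)

namespace Body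

variable {s : Body}

/-- The coefficients of `η` in the restriction of a covector to the constraint distribution. -/
def etaPart (hm : 0 < s.m) (hI : ∀ i, 0 < s.I i) (z : s.constraintManifold) :
    Cotangent s.constraintManifold (z : Ambient) →ₗ[ℝ] V3 :=
  LinearMap.pi fun i => LinearMap.applyₗ ((coordinates hm hI z).symm (Pi.single i 1, 0)).1

/-- The coefficients of `κ` in the restriction of a covector to the constraint distribution. -/
def kappaPart (hm : 0 < s.m) (hI : ∀ i, 0 < s.I i) (z : s.constraintManifold) :
    Cotangent s.constraintManifold (z : Ambient) →ₗ[ℝ] V3 :=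
  LinearMap.pi fun i => LinearMap.applyₗ ((coordinates hm hI z).symm (0, Pi.single i 1)).1

theorem apply_coordinates_symm (hm : 0 < s.m) (hI : ∀ i, 0 < s.I i) (z : s.constraintManifold)
    (α : Cotangent s.constraintManifold (z : Ambient)) (x : V3 × V3) :
    α ((coordinates hm hI z).symm x).1 =
      etaPart hm hI z α ⬝ᵥ x.1 + kappaPart hm hI z α ⬝ᵥ x.2 :=
  dual_apply_prod (α ∘ₗ (s.distribution z).subtype ∘ₗ (coordinates hm hI z).symm.toLinearMap) x

/-- The value at `z` of the bivector field on the constraint manifold determined by the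
vector-valued function `W`. -/
def bivectorAt (hm : 0 < s.m) (hI : ∀ i, 0 < s.I i) (W : Ambient → V3)
    (z : s.constraintManifold) : Cotangent s.constraintManifold (z : Ambient) →ₗ[ℝ]
      Cotangent s.constraintManifold (z : Ambient) →ₗ[ℝ] ℝ :=
  LinearMap.mk₂ ℝ (fun α β => etaPart hm hI z α ⬝ᵥ kappaPart hm hI z β -
      etaPart hm hI z β ⬝ᵥ kappaPart hm hI z α -
      W z ⬝ᵥ (kappaPart hm hI z α ⨯₃ kappaPart hm hI z β))
    (fun α α' β => by
      simp only [map_add, add_dotProduct, dotProduct_add, LinearMap.add_apply]; ring)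
    (fun a α β => by
      simp only [map_smul, smul_dotProduct, dotProduct_smul, LinearMap.smul_apply, smul_eq_mul]
      ring)
    (fun α β β' => by
      simp only [map_add, add_dotProduct, dotProduct_add]; ring)
    (fun a α β => by
      simp only [map_smul, smul_dotProduct, dotProduct_smul, smul_eq_mul]
      ring)

theorem bivectorAt_apply (hm : 0 < s.m) (hI : ∀ i, 0 < s.I i) (W : Ambient → V3)
    (z : s.constraintManifold) (α β : Cotangent s.constraintManifold (z : Ambient)) :
    bivectorAt hm hI W z α β = etaPart hm hI z α ⬝ᵥ kappaPart hm hI z β -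
      etaPart hm hI z β ⬝ᵥ kappaPart hm hI z α -
      W z ⬝ᵥ (kappaPart hm hI z α ⨯₃ kappaPart hm hI z β) := rfl

/-- The coefficients of the differential of a function, as functions on the ambient space. -/
theorem contDiffOn_fderiv_frame (hm : 0 < s.m) (hI : ∀ i, 0 < s.I i) {F : Ambient → ℝ}
    {U : Set Ambient} (hU : IsOpen U) (hF : ContDiffOn ℝ ∞ F U) (η κ : V3) :
    ContDiffOn ℝ ∞ (fun z => fderiv ℝ F z (s.frame z η κ)) U :=
  (hF.fderiv_of_isOpen hU (by simp)).clm_apply (contDiff_frame hm hI η κ).contDiffOn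

/-- The bivector field on the constraint manifold determined by a vector-valued function `W`. -/
def bivectorField (hm : 0 < s.m) (hI : ∀ i, 0 < s.I i) (W : Ambient → V3)
    (hW : ContDiff ℝ ∞ W) : BivectorField s.constraintManifold where
  toFun := bivectorAt hm hI W
  alternating z α := by rw [bivectorAt_apply, cross_self, dotProduct_zero]; ring
  smooth f g z := by
    obtain ⟨F, U, hU, hzU, hF, hfF⟩ := f.2 z
    obtain ⟨G, V, hV, hzV, hG, hgG⟩ := g.2 z
    -- The frame is defined and smooth at all ambient points, so the coefficients of df and dg
    -- extend to the derivatives of local extensions along it.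
    refine ⟨fun y =>
      (fun i => fderiv ℝ F y (s.frame y (Pi.single i 1) 0)) ⬝ᵥ
        (fun i => fderiv ℝ G y (s.frame y 0 (Pi.single i 1))) -
      (fun i => fderiv ℝ G y (s.frame y (Pi.single i 1) 0)) ⬝ᵥ
        (fun i => fderiv ℝ F y (s.frame y 0 (Pi.single i 1))) -
      W y ⬝ᵥ ((fun i => fderiv ℝ F y (s.frame y 0 (Pi.single i 1))) ⨯₃
        (fun i => fderiv ℝ G y (s.frame y 0 (Pi.single i 1)))),
      U ∩ V, hU.inter hV, ⟨hzU, hzV⟩, ?_, fun w hw => ?_⟩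
    · have hF1 := contDiffOn_pi.2 fun i => contDiffOn_fderiv_frame hm hI (hU.inter hV)
        (hF.mono Set.inter_subset_left) (Pi.single i 1) 0
      have hF2 := contDiffOn_pi.2 fun i => contDiffOn_fderiv_frame hm hI (hU.inter hV)
        (hF.mono Set.inter_subset_left) 0 (Pi.single i 1)
      have hG1 := contDiffOn_pi.2 fun i => contDiffOn_fderiv_frame hm hI (hU.inter hV)
        (hG.mono Set.inter_subset_right) (Pi.single i 1) 0
      have hG2 := contDiffOn_pi.2 fun i => contDiffOn_fderiv_frame hm hI (hU.inter hV)
        (hG.mono Set.inter_subset_right) 0 (Pi.single i 1)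
      exact ((contDiffOn_dotProduct hF1 hG2).sub (contDiffOn_dotProduct hG1 hF2)).sub
        (contDiffOn_dotProduct hW.contDiffOn (contDiffOn_cross hF2 hG2))
    · have hf := differential_apply f w F U hU hw.1 hF hfF
      have hg := differential_apply g w G V hV hw.2 hG hgG
      simp only [bivectorAt_apply]
      have h1 : etaPart hm hI w (differential f w) =
        fun i => fderiv ℝ F w (s.frame w (Pi.single i 1) 0) := funext fun i => hf _
      have h2 : kappaPart hm hI w (differential f w) =
        fun i => fderiv ℝ F w (s.frame w 0 (Pi.single i 1)) := funext fun i => hf _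
      have h3 : etaPart hm hI w (differential g w) =
        fun i => fderiv ℝ G w (s.frame w (Pi.single i 1) 0) := funext fun i => hg _
      have h4 : kappaPart hm hI w (differential g w) =
        fun i => fderiv ℝ G w (s.frame w 0 (Pi.single i 1)) := funext fun i => hg _
      rw [h1, h2, h3, h4]

/-- Let a, b be the coefficients of η and κ in α. Solving −(κ·η' − κ'·η − W·(η × η')) = a·η' + b·κ'
for all (η', κ') gives η = b and κ = W × b − a. -/
theorem bivectorField_sharp (hm : 0 < s.m) (hI : ∀ i, 0 < s.I i) (W : Ambient → V3)
    (hW : ContDiff ℝ ∞ W) (z : s.constraintManifold)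
    (α : Cotangent s.constraintManifold (z : Ambient)) :
    (bivectorField hm hI W hW).sharp z α = -((coordinates hm hI z).symm
      (kappaPart hm hI z α, W z ⨯₃ kappaPart hm hI z α - etaPart hm hI z α)).1 := by
  refine BivectorField.sharp_eq_of_apply fun β => ?_
  rw [map_neg, apply_coordinates_symm]
  change _ = bivectorAt hm hI W z α β
  rw [bivectorAt_apply, dotProduct_sub, dotProduct_comm (etaPart hm hI z α),
    dot_cross_eq_cross_dot (W z), dotProduct_comm (W z ⨯₃ _)]
  ring

/-- The bivector field determined by `W` is associated to every 2-form that restricts to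
`-(dK ∧ λ - W · (λ × λ))` on the constraint distribution. -/
theorem isAssociatedBivector_bivectorField (hm : 0 < s.m) (hI : ∀ i, 0 < s.I i)
    (W : Ambient → V3) (hW : ContDiff ℝ ∞ W) {σ : TwoForm Ambient}
    (hσ : ∀ (z : s.constraintManifold) (v w : s.distribution z),
      σ z ![(v.1 : Ambient), (w.1 : Ambient)] =
        -((coordinates hm hI z v).2 ⬝ᵥ (coordinates hm hI z w).1 -
          (coordinates hm hI z w).2 ⬝ᵥ (coordinates hm hI z v).1 -
          W z ⬝ᵥ ((coordinates hm hI z v).1 ⨯₃ (coordinates hm hI z w).1))) :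
    IsAssociatedBivector s.distribution σ (bivectorField hm hI W hW) := by
  intro z α X
  rw [bivectorField_sharp, neg_inj]
  set e := coordinates hm hI z
  set a := etaPart hm hI z α
  set b := kappaPart hm hI z α
  have hα : ∀ Y : s.distribution z, α Y.1 = a ⬝ᵥ (e Y).1 + b ⬝ᵥ (e Y).2 := by
    intro Y
    rw [← apply_coordinates_symm]
    simp [e]
  constructor
  · rintro rfl
    refine ⟨Subtype.prop _, fun Y hY => ?_⟩
    rw [hσ z _ ⟨Y, hY⟩, hα ⟨Y, hY⟩]
    simp only [LinearEquiv.apply_symm_apply, e]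
    rw [sub_dotProduct, dotProduct_comm b, dot_cross_eq_cross_dot]
    ring
  · rintro ⟨hX, h⟩
    obtain ⟨x, hx⟩ : ∃ x, x = e ⟨X, hX⟩ := ⟨_, rfl⟩
    have h1 : ∀ y : V3 × V3, -(x.2 ⬝ᵥ y.1 - y.2 ⬝ᵥ x.1 - W z ⬝ᵥ (x.1 ⨯₃ y.1)) =
        a ⬝ᵥ y.1 + b ⬝ᵥ y.2 := by
      intro y
      have h2 := h (e.symm y).1 (e.symm y).2
      rw [hσ z ⟨X, hX⟩ (e.symm y), hα (e.symm y)] at h2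
      simpa [e, hx] using h2
    -- Testing against pure κ-vectors yields the η-component; testing against pure η-vectors then
    -- yields the κ-component.
    have hx1 : x.1 = b := by
      ext i
      have := h1 (0, Pi.single i 1)
      simpa using this
    have hx2 : x.2 = W z ⨯₃ b - a := by
      ext i
      have := h1 (Pi.single i 1, 0)
      rw [hx1, dot_cross_eq_cross_dot] at this
      simp at this ⊢
      linarith
    have : e.symm (b, W z ⨯₃ b - a) = ⟨X, hX⟩ := by
      rw [LinearEquiv.symm_apply_eq, ← hx, ← hx1]
      exact Prod.ext rfl (by rw [hx2, hx1])
    rw [this]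

end Body

/-! ### The nonholonomic bivector field and its dynamical gauge transformation -/

namespace Body

variable (s : Body)

/-- The vector that multiplies `λ × λ` in the canonical form on the constraint distribution. -/
def nonholonomicVector (z : Ambient) : V3 := z.2.2.1 + (2 : ℝ) • s.rollingMomentum z

/-- The vector that multiplies `λ × λ` after the gauge transformation. -/
def gaugedVector (z : Ambient) : V3 := s.nonholonomicVector z - s.mr2 • s.angularVelocity z

theorem contDiff_nonholonomicVector : ContDiff ℝ ∞ s.nonholonomicVector :=
  ContDiff.add (by fun_prop) (s.contDiff_rollingMomentum.const_smul _)

theorem contDiff_gaugedVector : ContDiff ℝ ∞ s.gaugedVector :=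
  s.contDiff_nonholonomicVector.sub (s.contDiff_angularVelocity.const_smul _)

variable {s}

/-- The nonholonomic bivector field. -/
def nonholonomicBivector (hm : 0 < s.m) (hI : ∀ i, 0 < s.I i) :
    BivectorField s.constraintManifold :=
  bivectorField hm hI s.nonholonomicVector s.contDiff_nonholonomicVector

/-- The gauge transformation of the nonholonomic bivector field. -/
def gaugedBivector (hm : 0 < s.m) (hI : ∀ i, 0 < s.I i) : BivectorField s.constraintManifold :=
  bivectorField hm hI s.gaugedVector s.contDiff_gaugedVector

theorem isNonholonomicBivector (hm : 0 < s.m) (hI : ∀ i, 0 < s.I i) :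
    s.IsNonholonomicBivector (nonholonomicBivector hm hI) :=
  isAssociatedBivector_bivectorField hm hI _ _ fun z v w =>
    canonicalForm_apply hI z v.2 w.2

/-- On 𝒞 the form Ω_Q − B has the same normal form as Ω_Q, with W lowered by mr²Ω. -/
theorem isGaugeTransformOf (hm : 0 < s.m) (hI : ∀ i, 0 < s.I i) :
    IsGaugeTransformOf s.gaugeForm (nonholonomicBivector hm hI) (gaugedBivector hm hI) := by
  refine (isNonholonomicBivector hm hI).isGaugeTransformOf
    (isAssociatedBivector_bivectorField hm hI _ _ fun z v w => ?_)
  rw [ContinuousAlternatingMap.sub_apply, canonicalForm_apply hI z v.2 w.2, gaugeForm_apply hI,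
    gaugedVector, sub_dotProduct]
  change _ = -(s.momentumVelocity z v.1 ⬝ᵥ lam (mat z) (mat w.1) -
    s.momentumVelocity z w.1 ⬝ᵥ lam (mat z) (mat v.1) -
    (s.nonholonomicVector z ⬝ᵥ (lam (mat z) (mat v.1) ⨯₃ lam (mat z) (mat w.1)) -
      (s.mr2 • s.angularVelocity z) ⬝ᵥ (lam (mat z) (mat v.1) ⨯₃ lam (mat z) (mat w.1))))
  rw [nonholonomicVector]
  ring

theorem fderiv_hamiltonian (z v : Ambient) :
    fderiv ℝ s.hamiltonian z v =
      (fun i => s.I i * s.angularVelocity v i) ⬝ᵥ s.angularVelocity z +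
        s.m * ((s.m⁻¹ • z.2.2.2) ⬝ᵥ (s.m⁻¹ • v.2.2.2)) := by
  refine fderiv_eq_of_expansion (b := s.hamiltonian v)
    (s.contDiff_hamiltonian.differentiable (by simp) z) fun t => ?_
  simp only [hamiltonian, lagrangian, legendreInv, angularVelocity_add, angularVelocity_smul,
    dotProduct, Fin.sum_univ_three, Pi.add_apply, Pi.smul_apply, Prod.snd_add, Prod.smul_snd,
    smul_eq_mul]
  ring

/-- The derivative of the Hamiltonian in the direction of `K` is the angular velocity. -/
theorem fderiv_hamiltonian_frame (hm : 0 < s.m) (hI : ∀ i, 0 < s.I i)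
    (z : s.constraintManifold) (κ : V3) :
    fderiv ℝ s.hamiltonian z (s.frame z 0 κ) = s.angularVelocity z ⬝ᵥ κ := by
  have hp := ((mem_constraintManifold_iff hI _).1 z.2).2
  -- For η = 0 the rotation is at rest, so κ = Ṁ + r(Ag)ᵀṗ. Pairing this with Ω gives the derivative
  -- of the energy, because p = mrAgΩ.
  have h0 : mat (s.frame z 0 κ) = 0 := by
    rw [mat_frame, show hat 0 = 0 by ext i j; fin_cases i <;> fin_cases j <;> simp [hat],
      Matrix.mul_zero]
  have h1 := momentumVelocity_frame hm hI z 0 κ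
  rw [momentumVelocity, h0, Matrix.mul_zero, Matrix.transpose_zero, Matrix.zero_mulVec,
    zero_add] at h1
  rw [fderiv_hamiltonian, ← funext (momenta_eq hI _), hp]
  conv_rhs => rw [← h1]
  have h2 : s.angularVelocity z ⬝ᵥ ((s.A * mat z)ᵀ *ᵥ (s.frame z 0 κ).2.2.2) =
      ((s.A * mat z) *ᵥ s.angularVelocity z) ⬝ᵥ (s.frame z 0 κ).2.2.2 := by
    rw [Matrix.mulVec_transpose, dotProduct_comm, ← Matrix.dotProduct_mulVec, dotProduct_comm]
  have hm' := hm.ne'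
  simp only [dotProduct_add, dotProduct_smul, smul_dotProduct, smul_eq_mul, h2]
  rw [dotProduct_comm (s.angularVelocity z)]
  field_simp

/-- The η-component of the Hamiltonian vector field is the κ-coefficient of the differential of the
Hamiltonian, namely Ω; then B contracts to a triple product with Ω repeated. -/
theorem isDynamicalGauge (hm : 0 < s.m) (hI : ∀ i, 0 < s.I i) :
    IsDynamicalGauge s.gaugeForm (nonholonomicBivector hm hI) s.constrainedHamiltonian := by
  refine ⟨fun z Y => ?_, _, isGaugeTransformOf hm hI⟩
  have h1 : kappaPart hm hI z (differential s.constrainedHamiltonian z) =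
      s.angularVelocity z := by
    ext i
    have h2 := differential_apply s.constrainedHamiltonian z s.hamiltonian Set.univ isOpen_univ
      (Set.mem_univ _) s.contDiff_hamiltonian.contDiffOn (fun _ _ => rfl)
      ((coordinates hm hI z).symm (0, Pi.single i 1)).1
    refine h2.trans ((fderiv_hamiltonian_frame hm hI z (Pi.single i 1)).trans ?_)
    simp
  obtain ⟨X, hX⟩ : ∃ X, X = (coordinates hm hI z).symm (s.angularVelocity z,
    s.nonholonomicVector z ⨯₃ s.angularVelocity z -
      etaPart hm hI z (differential s.constrainedHamiltonian z)) := ⟨_, rfl⟩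
  have h3 : (nonholonomicBivector hm hI).hamiltonianVectorField s.constrainedHamiltonian z =
      X.1 := by
    rw [BivectorField.hamiltonianVectorField, nonholonomicBivector, bivectorField_sharp, neg_neg,
      h1, hX]
  have h4 : lam (mat z) (mat X.1) = s.angularVelocity z := by
    change ((coordinates hm hI z) X).1 = _
    rw [hX, LinearEquiv.apply_symm_apply]
  rw [h3, gaugeForm_apply hI, h4, smul_dotProduct, dot_self_cross, smul_zero]

end Body

/-! ### Rotations, the symmetry group and the constraint matrices -/

/-- The rows u, γ × u, γ work for any unit vector u orthogonal to γ. Such a u is the normalized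
horizontal vector (−γ₁, γ₀, 0), or the first basis vector when γ is vertical. -/
theorem exists_rotation (γ : V3) (hγ : γ ⬝ᵥ γ = 1) : ∃ g ∈ SO3, gᵀ *ᵥ e3 = γ := by
  have key : ∃ u : V3, u ⬝ᵥ u = 1 ∧ u ⬝ᵥ γ = 0 := by
    by_cases h : γ 0 ^ 2 + γ 1 ^ 2 = 0
    · have h0 : γ 0 = 0 := by nlinarith [sq_nonneg (γ 0), sq_nonneg (γ 1)]
      exact ⟨![1, 0, 0], by simp [dotProduct, Fin.sum_univ_three],
        by simp [dotProduct, Fin.sum_univ_three, h0]⟩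
    · have hpos : 0 < γ 0 ^ 2 + γ 1 ^ 2 := lt_of_le_of_ne (by positivity) (Ne.symm h)
      obtain ⟨q, hq⟩ : ∃ q : ℝ, q = Real.sqrt (γ 0 ^ 2 + γ 1 ^ 2) := ⟨_, rfl⟩
      have hq2 : q ^ 2 = γ 0 ^ 2 + γ 1 ^ 2 := hq ▸ Real.sq_sqrt hpos.le
      have hq0 : q ≠ 0 := hq ▸ (Real.sqrt_pos.2 hpos).ne'
      refine ⟨![-γ 1 / q, γ 0 / q, 0], ?_, ?_⟩
      · simp [dotProduct, Fin.sum_univ_three]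
        field_simp
        linarith
      · simp [dotProduct, Fin.sum_univ_three]
        field_simp
        ring
  obtain ⟨u, hu, huγ⟩ := key
  obtain ⟨w, hw⟩ : ∃ w, w = γ ⨯₃ u := ⟨_, rfl⟩
  have hwγ : w ⬝ᵥ γ = 0 := by rw [hw, dotProduct_comm, dot_self_cross]
  have hwu : w ⬝ᵥ u = 0 := by rw [hw, dotProduct_comm, dot_cross_self]
  have hww : w ⬝ᵥ w = 1 := by
    rw [hw, cross_dot_cross, hγ, hu, dotProduct_comm γ, huγ]
    ring
  refine ⟨Matrix.of ![u, w, γ], mem_SO3_iff.2 ⟨?_, ?_⟩, ?_⟩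
  · have h : ∀ i j, (Matrix.of ![u, w, γ] * (Matrix.of ![u, w, γ])ᵀ) i j =
        ![u, w, γ] i ⬝ᵥ ![u, w, γ] j := fun i j => rfl
    ext i j
    rw [h]
    fin_cases i <;> fin_cases j <;>
      simp [hu, huγ, hγ, hwγ, hwu, hww, dotProduct_comm u w, dotProduct_comm γ]
  · have h := triple_product_eq_det u w γ
    rw [triple_product_permutation, ← hw, hww] at h
    exact h.symm
  · ext i
    simp [Matrix.mulVec, dotProduct, Fin.sum_univ_three, e3]

theorem specialOrthogonal_two_entries {C : Matrix (Fin 2) (Fin 2) ℝ}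
    (hC : C ∈ Matrix.specialOrthogonalGroup (Fin 2) ℝ) :
    C 0 0 = C 1 1 ∧ C 0 1 = -C 1 0 ∧ C 1 1 ^ 2 + C 1 0 ^ 2 = 1 := by
  obtain ⟨h1, h2⟩ := Matrix.mem_specialOrthogonalGroup_iff.1 hC
  rw [Matrix.mem_orthogonalGroup_iff] at h1
  rw [Matrix.det_fin_two] at h2
  have h00 := congrFun (congrFun h1 0) 0
  have h11 := congrFun (congrFun h1 1) 1
  simp [Matrix.mul_apply, Fin.sum_univ_two] at h00 h11
  -- The left side is the sum of the squared entries minus twice the determinant, that is, 2 − 2.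
  have hs : (C 0 0 - C 1 1) ^ 2 + (C 0 1 + C 1 0) ^ 2 = 0 := by nlinarith
  have ha : C 0 0 - C 1 1 = 0 := by
    nlinarith [sq_nonneg (C 0 0 - C 1 1), sq_nonneg (C 0 1 + C 1 0)]
  have hb : C 0 1 + C 1 0 = 0 := by
    nlinarith [sq_nonneg (C 0 0 - C 1 1), sq_nonneg (C 0 1 + C 1 0)]
  exact ⟨by linarith, by linarith, by linarith⟩

/-- Fixing e₃ fixes the last column; by orthogonality hᵀ fixes e₃ too, which fixes the last row. The
remaining block is a planar rotation. -/
theorem exists_symmetry_entries {h : M3} (hh : h ∈ SO3) (he : h *ᵥ e3 = e3) :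
    ∃ a b : ℝ, h = !![a, -b, 0; b, a, 0; 0, 0, 1] := by
  have he' : hᵀ *ᵥ e3 = e3 := by
    conv_lhs => rw [← he]
    rw [Matrix.mulVec_mulVec, transpose_mul_self_of_mem hh, Matrix.one_mulVec]
  have hc : ∀ i, h i 2 = e3 i := fun i => by
    rw [← congrFun he i]
    simp [Matrix.mulVec, dotProduct, Fin.sum_univ_three, e3]
  have hr : ∀ i, h 2 i = e3 i := fun i => by
    rw [← congrFun he' i]
    simp [Matrix.mulVec, dotProduct, Fin.sum_univ_three, e3]
  obtain ⟨h1, h2⟩ := mem_SO3_iff.1 hh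
  have c0 := hc 0; have c1 := hc 1; have c2 := hc 2; have r0 := hr 0; have r1 := hr 1
  simp [e3] at c0 c1 c2 r0 r1
  have h00 := congrFun (congrFun h1 0) 0
  have h11 := congrFun (congrFun h1 1) 1
  rw [Matrix.det_fin_three] at h2
  simp [Matrix.mul_apply, Fin.sum_univ_three, c0, c1, c2, r0, r1] at h00 h11 h2
  have hs : (h 0 0 - h 1 1) ^ 2 + (h 0 1 + h 1 0) ^ 2 = 0 := by nlinarith
  have ha : h 0 0 - h 1 1 = 0 := by
    nlinarith [sq_nonneg (h 0 0 - h 1 1), sq_nonneg (h 0 1 + h 1 0)]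
  have hb : h 0 1 + h 1 0 = 0 := by
    nlinarith [sq_nonneg (h 0 0 - h 1 1), sq_nonneg (h 0 1 + h 1 0)]
  refine ⟨h 1 1, h 1 0, ?_⟩
  ext i j
  fin_cases i <;> fin_cases j <;> simp [c0, c1, c2, r0, r1] <;> linarith

/-- Planar rotations commute with each other, and the vertical entry of A is a scalar block. This is
what makes the constraint H-invariant. -/
theorem symmetry_commute {A h : M3} (hA : DefinesGeneralizedRolling A) (hh : h ∈ SO3)
    (he : h *ᵥ e3 = e3) : h * A = A * h := by
  obtain ⟨a, b, rfl⟩ := exists_symmetry_entries hh he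
  rcases hA with ⟨-, C, hC, rfl⟩ | ⟨-, C, hC, rfl⟩ | ⟨-, rfl⟩ | ⟨-, rfl⟩
  · obtain ⟨h1, h2, -⟩ := specialOrthogonal_two_entries hC
    rw [h1, h2]
    ext i j
    fin_cases i <;> fin_cases j <;> simp [Matrix.mul_apply, Fin.sum_univ_three] <;> ring
  · obtain ⟨h1, h2, -⟩ := specialOrthogonal_two_entries hC
    rw [h1, h2]
    ext i j
    fin_cases i <;> fin_cases j <;> simp [Matrix.mul_apply, Fin.sum_univ_three] <;> ring
  · ext i j
    fin_cases i <;> fin_cases j <;>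
      simp [Matrix.mul_apply, Fin.sum_univ_three, e3]
  · simp

/-- `gᵀ Aᵀ A g v` as a function of `γ = gᵀ e₃`, for each rank of `A`. -/
def gramVector (j : Fin 4) (γ v : V3) : V3 :=
  match j with
  | 0 => 0
  | 1 => (γ ⬝ᵥ v) • γ
  | 2 => v - (γ ⬝ᵥ v) • γ
  | 3 => v

/-- As CᵀC is the identity, AᵀA is a coordinate projection depending only on the rank, and C
disappears from the reduced data. -/
theorem transpose_mul_self_mulVec {A : M3} (hA : DefinesGeneralizedRolling A) {j : Fin 4}
    (hj : A.rank = (j : ℕ)) (v : V3) : (Aᵀ * A) *ᵥ v = gramVector j e3 v := by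
  rcases hA with ⟨hr, C, hC, rfl⟩ | ⟨hr, C, hC, rfl⟩ | ⟨hr, rfl⟩ | ⟨hr, rfl⟩
  · obtain rfl : j = 3 := Fin.ext (hj.symm.trans hr)
    obtain ⟨h1, h2, h3⟩ := specialOrthogonal_two_entries hC
    rw [h1, h2]
    ext i
    fin_cases i <;> simp [gramVector, Matrix.mulVec, Matrix.mul_apply, dotProduct,
      Fin.sum_univ_three] <;> grind
  · obtain rfl : j = 2 := Fin.ext (hj.symm.trans hr)
    obtain ⟨h1, h2, h3⟩ := specialOrthogonal_two_entries hC
    rw [h1, h2]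
    ext i
    fin_cases i <;> simp [gramVector, Matrix.mulVec, Matrix.mul_apply, dotProduct,
      Fin.sum_univ_three, e3] <;> grind
  · obtain rfl : j = 1 := Fin.ext (hj.symm.trans hr)
    ext i
    fin_cases i <;> simp [gramVector, Matrix.mulVec, Matrix.mul_apply, dotProduct,
      Fin.sum_univ_three, e3]
  · obtain rfl : j = 0 := Fin.ext (hj.symm.trans hr)
    simp [gramVector]

theorem transpose_mulVec_gramVector {g : M3} (hg : g ∈ SO3) (j : Fin 4) (v : V3) :
    gᵀ *ᵥ gramVector j e3 (g *ᵥ v) = gramVector j (gᵀ *ᵥ e3) v := by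
  have h1 : gᵀ *ᵥ (g *ᵥ v) = v := by
    rw [Matrix.mulVec_mulVec, transpose_mul_self_of_mem hg, Matrix.one_mulVec]
  have h2 : e3 ⬝ᵥ (g *ᵥ v) = (gᵀ *ᵥ e3) ⬝ᵥ v := by
    rw [Matrix.dotProduct_mulVec, Matrix.mulVec_transpose]
  fin_cases j
  · simp [gramVector]
  · simp [gramVector, Matrix.mulVec_smul, h2]
  · simp only [gramVector, Matrix.mulVec_sub, Matrix.mulVec_smul, h1, h2]
  · exact h1

/-! ### The angular velocity as a function of (γ, K) -/

namespace Body

variable {s : Body}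

theorem gramMatrix_mulVec (hA : DefinesGeneralizedRolling s.A) {j : Fin 4}
    (hj : s.A.rank = (j : ℕ)) {z : Ambient} (hz : mat z ∈ SO3) (v : V3) :
    s.gramMatrix z *ᵥ v = gramVector j ((mat z)ᵀ *ᵥ e3) v := by
  rw [← transpose_mulVec_gramVector hz, ← transpose_mul_self_mulVec hA hj, gramMatrix,
    Matrix.transpose_mul]
  simp only [← Matrix.mulVec_mulVec]

theorem rollingMomentum_eq (hI : ∀ i, 0 < s.I i) {z : Ambient} (hz : z ∈ s.constraintManifold) :
    s.rollingMomentum z = s.mr2 • (s.gramMatrix z *ᵥ s.angularVelocity z) := by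
  rw [rollingMomentum, ((mem_constraintManifold_iff hI z).1 hz).2, Matrix.mulVec_smul,
    Matrix.mulVec_mulVec, smul_smul, gramMatrix, mr2]
  congr 1
  ring

theorem orbitProjection_snd (hI : ∀ i, 0 < s.I i) {z : Ambient} (hz : z ∈ s.constraintManifold) :
    (s.orbitProjection z).2 = s.inertiaMatrix z *ᵥ s.angularVelocity z := by
  rw [inertiaMatrix_mulVec, ← rollingMomentum_eq hI hz, ← funext (momenta_eq hI z)]
  rfl

theorem omega_one_denom_pos (hm : 0 < s.m) (hI : ∀ i, 0 < s.I i) {γ : V3} (hγ : γ ≠ 0) :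
    0 < γ ⬝ᵥ γ + s.mr2 * (γ ⬝ᵥ s.invI γ) := by
  have h1 : 0 < γ ⬝ᵥ γ :=
    lt_of_le_of_ne (Finset.sum_nonneg fun i _ => mul_self_nonneg _)
      (Ne.symm (mt dotProduct_self_eq_zero.1 hγ))
  have h2 : 0 ≤ γ ⬝ᵥ s.invI γ := by
    refine Finset.sum_nonneg fun i _ => ?_
    simp only [invI, ← mul_div_assoc]
    exact div_nonneg (mul_self_nonneg _) (hI i).le
  have h3 : 0 ≤ s.mr2 := mul_nonneg hm.le (sq_nonneg _)
  positivity

/-- Termwise, 1 − mr²/(I_i + mr²) = I_i/(I_i + mr²) > 0. -/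
theorem omega_two_denom_pos (hm : 0 < s.m) (hI : ∀ i, 0 < s.I i) {γ : V3} (hγ : γ ≠ 0) :
    0 < γ ⬝ᵥ γ - s.mr2 * (γ ⬝ᵥ s.invJ γ) := by
  have h3 : 0 ≤ s.mr2 := mul_nonneg hm.le (sq_nonneg _)
  have h4 : γ ⬝ᵥ γ - s.mr2 * (γ ⬝ᵥ s.invJ γ) = ∑ i, γ i ^ 2 * (s.I i / (s.I i + s.mr2)) := by
    simp only [dotProduct, Finset.mul_sum, ← Finset.sum_sub_distrib, invJ]
    refine Finset.sum_congr rfl fun i _ => ?_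
    have : s.I i + s.mr2 ≠ 0 := by linarith [hI i]
    field_simp
    ring
  have h5 : ∀ i, 0 < s.I i / (s.I i + s.mr2) := fun i =>
    div_pos (hI i) (add_pos_of_pos_of_nonneg (hI i) h3)
  obtain ⟨i, hi⟩ := Function.ne_iff.1 hγ
  rw [h4]
  exact Finset.sum_pos' (fun i _ => mul_nonneg (sq_nonneg _) (h5 i).le)
    ⟨i, Finset.mem_univ i, mul_pos (sq_pos_of_ne_zero hi) (h5 i)⟩

/-- In ranks 1 and 2 the inertia matrix is diagonal plus or minus mr²γγᵀ, and `omega` is its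
Sherman–Morrison inverse. Pairing K with 𝕀⁻¹γ (or 𝕁⁻¹γ) gives γ·v times the denominator, so the
quotient is exactly γ·v and the correction term cancels. -/
theorem omega_eq_of_gramVector (hm : 0 < s.m) (hI : ∀ i, 0 < s.I i) (j : Fin 4) {γ v : V3}
    (hγ : γ ⬝ᵥ γ = 1) :
    s.omega j (γ, (fun i => s.I i * v i) + s.mr2 • gramVector j γ v) = v := by
  have hmr : 0 ≤ s.mr2 := mul_nonneg hm.le (sq_nonneg _)
  have hγ0 : γ ≠ 0 := by
    rintro rfl
    simp at hγ
  have hJ : ∀ i, s.I i + s.mr2 ≠ 0 := fun i => by linarith [hI i]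
  have hI' : ∀ i, s.I i ≠ 0 := fun i => (hI i).ne'
  have hinvI : ∀ c : ℝ, s.invI ((fun i => s.I i * v i) + c • γ) = v + c • s.invI γ := by
    intro c
    ext i
    have := hI' i
    simp only [invI, Pi.add_apply, Pi.smul_apply, smul_eq_mul]
    field_simp
  have hinvJ : ∀ c : ℝ, s.invJ ((fun i => s.I i * v i) + s.mr2 • v - c • γ) =
      v - c • s.invJ γ := by
    intro c
    ext i
    have := hJ i
    simp only [invJ, Pi.add_apply, Pi.sub_apply, Pi.smul_apply, smul_eq_mul]
    field_simp
  match j with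
  | 0 =>
    -- Rank 0, like rank 3 below, has no γγᵀ term: this is the case c = 0.
    have := hinvI 0
    simpa [omega, gramVector] using this
  | 1 =>
    obtain ⟨c, hc⟩ : ∃ c, c = γ ⬝ᵥ v := ⟨_, rfl⟩
    obtain ⟨d, hd⟩ : ∃ d, d = γ ⬝ᵥ s.invI γ := ⟨_, rfl⟩
    have hden : 1 + s.mr2 * d ≠ 0 := by
      have := omega_one_denom_pos hm hI hγ0
      rw [hγ, ← hd] at this
      exact this.ne'
    have h1 : (fun i => s.I i * v i) ⬝ᵥ s.invI γ = c := by
      rw [hc]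
      refine Finset.sum_congr rfl fun i _ => ?_
      have := hI' i
      simp only [invI]
      field_simp
    simp only [omega, gramVector, smul_smul, hinvI, hγ, ← hc, ← hd, add_dotProduct,
      smul_dotProduct, h1, smul_eq_mul]
    rw [show (c + s.mr2 * c * d) / (1 + s.mr2 * d) = c by field_simp, add_sub_cancel_right]
  | 2 =>
    obtain ⟨c, hc⟩ : ∃ c, c = γ ⬝ᵥ v := ⟨_, rfl⟩
    obtain ⟨d, hd⟩ : ∃ d, d = γ ⬝ᵥ s.invJ γ := ⟨_, rfl⟩
    have hden : 1 - s.mr2 * d ≠ 0 := by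
      have := omega_two_denom_pos hm hI hγ0
      rw [hγ, ← hd] at this
      exact this.ne'
    have h1 : (fun i => s.I i * v i) ⬝ᵥ s.invJ γ + s.mr2 * (v ⬝ᵥ s.invJ γ) = c := by
      rw [hc]
      simp only [dotProduct, Finset.mul_sum, ← Finset.sum_add_distrib]
      refine Finset.sum_congr rfl fun i _ => ?_
      have := hJ i
      simp only [invJ]
      field_simp
    have h2 : (fun i => s.I i * v i) + s.mr2 • (v - c • γ) =
        (fun i => s.I i * v i) + s.mr2 • v - (s.mr2 * c) • γ := by module
    simp only [omega, gramVector, h2, hinvJ, hγ, ← hc, ← hd, add_dotProduct, sub_dotProduct,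
      smul_dotProduct, h1, smul_eq_mul]
    rw [show (c - s.mr2 * c * d) / (1 - s.mr2 * d) = c by field_simp, sub_add_cancel]
  | 3 =>
    have := hinvJ 0
    simpa [omega, gramVector] using this

end Body

/-! ### The orbit projection: submersion, fibres, and the bracket vector -/

theorem transpose_mulVec_dotProduct_self {g : M3} (hg : g ∈ SO3) :
    (gᵀ *ᵥ e3) ⬝ᵥ (gᵀ *ᵥ e3) = 1 := by
  rw [Matrix.dotProduct_mulVec, Matrix.vecMul_transpose, Matrix.mulVec_mulVec,
    mul_transpose_self_of_mem hg, Matrix.one_mulVec]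
  simp [e3, dotProduct, Fin.sum_univ_three]

theorem dotProduct_eq_zero_of_mem_tangentSpace {y w : RedAmbient}
    (hw : w ∈ tangentSpace reducedSpace y) : y.1 ⬝ᵥ w.1 = 0 := by
  have hP : ContDiff ℝ ∞ fun y : RedAmbient => y.1 ⬝ᵥ y.1 :=
    contDiffOn_univ.1 (contDiffOn_dotProduct contDiffOn_fst contDiffOn_fst)
  have h1 := fderiv_eq_zero_of_constant (S := reducedSpace) (hP.differentiable (by simp))
    (k := 1) (fun y hy => hy) hw
  rw [fderiv_eq_of_expansion (a := 2 * (y.1 ⬝ᵥ w.1)) (b := w.1 ⬝ᵥ w.1)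
    (hP.differentiable (by simp) y)] at h1
  · linarith
  · intro t
    simp only [Prod.fst_add, Prod.smul_fst, add_dotProduct, dotProduct_add, smul_dotProduct,
      dotProduct_smul, smul_eq_mul, dotProduct_comm w.1 y.1]
    ring

theorem cross_cross_self {γ w : V3} (hγ : γ ⬝ᵥ γ = 1) (hw : γ ⬝ᵥ w = 0) :
    γ ⨯₃ (w ⨯₃ γ) = w := by
  rw [cross_cross_eq_smul_sub_smul', hγ, dotProduct_comm w γ, hw, one_smul, zero_smul, sub_zero]

namespace Body

variable {s : Body}

theorem transpose_mat_frame (z : Ambient) (η κ : V3) :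
    (mat (s.frame z η κ))ᵀ *ᵥ e3 = ((mat z)ᵀ *ᵥ e3) ⨯₃ η := by
  rw [mat_frame, Matrix.transpose_mul, hat_transpose, ← Matrix.mulVec_mulVec, Matrix.neg_mulVec,
    hat_mulVec, cross_anticomm]

/-- From ġ = gη̂ and γ = gᵀe₃ one gets γ̇ = γ × η, while κ is the velocity of K by construction. -/
theorem fderiv_orbitProjection_frame (hm : 0 < s.m) (hI : ∀ i, 0 < s.I i) (z : Ambient)
    (η κ : V3) :
    fderiv ℝ s.orbitProjection z (s.frame z η κ) = (((mat z)ᵀ *ᵥ e3) ⨯₃ η, κ) := by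
  rw [fderiv_orbitProjection, transpose_mat_frame, momentumVelocity_frame hm hI]

theorem angularVelocity_eq_omega (hm : 0 < s.m) (hI : ∀ i, 0 < s.I i)
    (hA : DefinesGeneralizedRolling s.A) {j : Fin 4} (hj : s.A.rank = (j : ℕ)) {z : Ambient}
    (hz : z ∈ s.constraintManifold) :
    s.omega j (s.orbitProjection z) = s.angularVelocity z := by
  have hg := ((mem_constraintManifold_iff hI z).1 hz).1
  have h : s.orbitProjection z = ((mat z)ᵀ *ᵥ e3, (fun i => s.I i * s.angularVelocity z i) +
      s.mr2 • gramVector j ((mat z)ᵀ *ᵥ e3) (s.angularVelocity z)) := by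
    refine Prod.ext rfl ?_
    rw [orbitProjection_snd hI hz, inertiaMatrix_mulVec, gramMatrix_mulVec hA hj hg]
  rw [h, omega_eq_of_gramVector hm hI j (transpose_mulVec_dotProduct_self hg)]

/-- Writing M + 2r(Ag)ᵀp = K + r(Ag)ᵀp and expressing the last term through γ and Ω gives the four
vectors W_j. In rank 3 it cancels the −mr²Ω from the gauge; in rank 2 only the γ-component is left.
-/
theorem bracketVector_orbitProjection (hm : 0 < s.m) (hI : ∀ i, 0 < s.I i)
    (hA : DefinesGeneralizedRolling s.A) {j : Fin 4} (hj : s.A.rank = (j : ℕ)) {z : Ambient}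
    (hz : z ∈ s.constraintManifold) :
    s.bracketVector j (s.orbitProjection z) = s.gaugedVector z := by
  have hg := ((mem_constraintManifold_iff hI z).1 hz).1
  have h1 : s.gaugedVector z = (s.orbitProjection z).2 +
      s.mr2 • gramVector j ((mat z)ᵀ *ᵥ e3) (s.angularVelocity z) -
        s.mr2 • s.angularVelocity z := by
    rw [← gramMatrix_mulVec hA hj hg, ← rollingMomentum_eq hI hz]
    change z.2.2.1 + (2 : ℝ) • s.rollingMomentum z - _ =
      z.2.2.1 + s.rollingMomentum z + s.rollingMomentum z - _
    module
  have h2 := angularVelocity_eq_omega hm hI hA hj hz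
  rw [h1]
  match j with
  | 0 =>
    simp only [bracketVector, gramVector, h2]
    module
  | 1 =>
    simp only [bracketVector, gramVector, h2, dotProduct_comm (s.angularVelocity z)]
    change _ - _ + (s.mr2 * (((mat z)ᵀ *ᵥ e3) ⬝ᵥ s.angularVelocity z)) • ((mat z)ᵀ *ᵥ e3) = _
    module
  | 2 =>
    simp only [bracketVector, gramVector, h2, dotProduct_comm (s.angularVelocity z)]
    change _ - (s.mr2 * (((mat z)ᵀ *ᵥ e3) ⬝ᵥ s.angularVelocity z)) • ((mat z)ᵀ *ᵥ e3) = _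
    module
  | 3 =>
    simp only [bracketVector, gramVector]
    module

theorem mapsTo_liftedAction (hI : ∀ i, 0 < s.I i) (hA : DefinesGeneralizedRolling s.A)
    {k : M3 × V3} (hk : k ∈ symmetryGroup) :
    Set.MapsTo (liftedAction k) s.constraintManifold s.constraintManifold := by
  intro z hz
  obtain ⟨hg, hp⟩ := (mem_constraintManifold_iff hI z).1 hz
  refine (mem_constraintManifold_iff hI _).2 ⟨mul_mem hk.1 hg, ?_⟩
  change k.1 *ᵥ z.2.2.2 = (s.m * s.r) • ((s.A * (k.1 * mat z)) *ᵥ s.angularVelocity z)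
  rw [hp, Matrix.mulVec_smul, Matrix.mulVec_mulVec, ← Matrix.mul_assoc, ← Matrix.mul_assoc,
    symmetry_commute hA hk.1 hk.2]

theorem surjOn_orbitProjection (hm : 0 < s.m) (hI : ∀ i, 0 < s.I i) :
    Set.SurjOn s.orbitProjection s.constraintManifold reducedSpace := by
  rintro ⟨γ, K⟩ hγ
  obtain ⟨g, hg, hgγ⟩ := exists_rotation γ hγ
  -- The inertia matrix sees only g, so a point with zero momenta suffices to define Ω = L⁻¹K.
  let z₀ : Ambient := (Matrix.of.symm g, 0, 0, 0)
  obtain ⟨v, hv⟩ : ∃ v, v = (s.inertiaMatrix z₀)⁻¹ *ᵥ K := ⟨_, rfl⟩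
  let z : Ambient := (Matrix.of.symm g, 0, fun i => s.I i * v i, (s.m * s.r) • ((s.A * g) *ᵥ v))
  have hzv : s.angularVelocity z = v := by
    ext i
    have := (hI i).ne'
    simp only [angularVelocity, z]
    field_simp
  have hz : z ∈ s.constraintManifold := (mem_constraintManifold_iff hI z).2 ⟨hg, by rw [hzv]; rfl⟩
  refine ⟨z, hz, Prod.ext hgγ ?_⟩
  rw [orbitProjection_snd hI hz, hzv]
  exact (inertiaMatrix_mulVec_eq_iff hm hI z₀ _ _).2 hv

/-- Equal (γ, K) force equal Ω, hence equal M. The group element is h = g'gᵀ, which fixes e₃ because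
gᵀe₃ = g'ᵀe₃, with the translation that matches x; p then matches since h commutes with A. -/
theorem orbitProjection_eq_iff (hm : 0 < s.m) (hI : ∀ i, 0 < s.I i)
    (hA : DefinesGeneralizedRolling s.A) {j : Fin 4} (hj : s.A.rank = (j : ℕ)) {z z' : Ambient}
    (hz : z ∈ s.constraintManifold) (hz' : z' ∈ s.constraintManifold) :
    s.orbitProjection z = s.orbitProjection z' ↔ ∃ k ∈ symmetryGroup, z' = liftedAction k z := by
  obtain ⟨hg, hp⟩ := (mem_constraintManifold_iff hI z).1 hz
  obtain ⟨hg', hp'⟩ := (mem_constraintManifold_iff hI z').1 hz'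
  constructor
  · intro h
    have hΩ : s.angularVelocity z' = s.angularVelocity z := by
      rw [← angularVelocity_eq_omega hm hI hA hj hz, ← angularVelocity_eq_omega hm hI hA hj hz', h]
    have hγ : (mat z)ᵀ *ᵥ e3 = (mat z')ᵀ *ᵥ e3 := congrArg Prod.fst h
    have hh : mat z' * (mat z)ᵀ ∈ SO3 := by
      refine mul_mem hg' (mem_SO3_iff.2 ⟨?_, ?_⟩)
      · rw [Matrix.transpose_transpose, transpose_mul_self_of_mem hg]
      · rw [Matrix.det_transpose, (mem_SO3_iff.1 hg).2]
    have he : (mat z' * (mat z)ᵀ) *ᵥ e3 = e3 := by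
      rw [← Matrix.mulVec_mulVec, hγ, Matrix.mulVec_mulVec, mul_transpose_self_of_mem hg',
        Matrix.one_mulVec]
    have hgg : mat z' = mat z' * (mat z)ᵀ * mat z := by
      rw [Matrix.mul_assoc, transpose_mul_self_of_mem hg, Matrix.mul_one]
    refine ⟨(mat z' * (mat z)ᵀ, z'.2.1 - (mat z' * (mat z)ᵀ) *ᵥ z.2.1), ⟨hh, he⟩,
      Prod.ext ?_ (Prod.ext ?_ (Prod.ext ?_ ?_))⟩
    · exact congrArg Matrix.of.symm hgg
    · exact (add_sub_cancel _ _).symm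
    · change z'.2.2.1 = z.2.2.1
      rw [funext (momenta_eq hI z'), funext (momenta_eq hI z), hΩ]
    · change z'.2.2.2 = (mat z' * (mat z)ᵀ) *ᵥ z.2.2.2
      rw [hp, hp', hΩ, Matrix.mulVec_smul, Matrix.mulVec_mulVec, ← Matrix.mul_assoc _ s.A,
        symmetry_commute hA hh he, Matrix.mul_assoc s.A, ← hgg]
  · rintro ⟨k, hk, rfl⟩
    have hkk := transpose_mul_self_of_mem hk.1
    have hke : (k.1)ᵀ *ᵥ e3 = e3 := by
      conv_lhs => rw [← hk.2]
      rw [Matrix.mulVec_mulVec, hkk, Matrix.one_mulVec]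
    refine Prod.ext ?_ ?_
    · change (mat z)ᵀ *ᵥ e3 = (k.1 * mat z)ᵀ *ᵥ e3
      rw [Matrix.transpose_mul, ← Matrix.mulVec_mulVec, hke]
    · change z.2.2.1 + s.r • ((s.A * mat z)ᵀ *ᵥ z.2.2.2) =
        z.2.2.1 + s.r • ((s.A * (k.1 * mat z))ᵀ *ᵥ (k.1 *ᵥ z.2.2.2))
      rw [← Matrix.mul_assoc, ← symmetry_commute hA hk.1 hk.2, Matrix.mul_assoc,
        Matrix.transpose_mul k.1, Matrix.mulVec_mulVec, Matrix.mul_assoc, hkk, Matrix.mul_one]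

theorem isOrbitSpace (hm : 0 < s.m) (hI : ∀ i, 0 < s.I i)
    (hA : DefinesGeneralizedRolling s.A) {j : Fin 4} (hj : s.A.rank = (j : ℕ)) :
    s.IsOrbitSpace := by
  refine ⟨fun k hk => mapsTo_liftedAction hI hA hk, surjOn_orbitProjection hm hI,
    fun z hz w hw => ?_, fun z hz z' hz' => orbitProjection_eq_iff hm hI hA hj hz hz'⟩
  have hg := ((mem_constraintManifold_iff hI z).1 hz).1
  -- For γ̇ orthogonal to the unit vector γ, the choice η = γ̇ × γ solves γ × η = γ̇.
  refine ⟨s.frame z (w.1 ⨯₃ ((mat z)ᵀ *ᵥ e3)) w.2, frame_mem_tangentSpace hI hz _ _, ?_⟩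
  rw [fderiv_orbitProjection_frame hm hI, cross_cross_self (transpose_mulVec_dotProduct_self hg)
    (dotProduct_eq_zero_of_mem_tangentSpace hw)]

/-! ### The Casimir and the reduced bracket -/

/-- The gradient is (2γ, 0), so the only surviving term is a triple product containing γ twice. -/
theorem primedBracket_casimir (j : Fin 4) (F : RedAmbient → ℝ) (y : RedAmbient) :
    s.primedBracket j F (fun w => w.1 ⬝ᵥ w.1) y = 0 := by
  have hP : ContDiff ℝ ∞ fun y : RedAmbient => y.1 ⬝ᵥ y.1 :=
    contDiffOn_univ.1 (contDiffOn_dotProduct contDiffOn_fst contDiffOn_fst)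
  have h : ∀ w : RedAmbient,
      fderiv ℝ (fun y : RedAmbient => y.1 ⬝ᵥ y.1) y w = 2 * (y.1 ⬝ᵥ w.1) := by
    intro w
    refine fderiv_eq_of_expansion (b := w.1 ⬝ᵥ w.1) (hP.differentiable (by simp) y) fun t => ?_
    simp only [Prod.fst_add, Prod.smul_fst, add_dotProduct, dotProduct_add, smul_dotProduct,
      dotProduct_smul, smul_eq_mul, dotProduct_comm w.1 y.1]
    ring
  have h1 : gradK (fun w : RedAmbient => w.1 ⬝ᵥ w.1) y = 0 := by
    ext i
    simp [gradK, h]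
  have h2 : gradGamma (fun w : RedAmbient => w.1 ⬝ᵥ w.1) y = (2 : ℝ) • y.1 := by
    ext i
    simp [gradGamma, h]
  rw [primedBracket, h1, h2]
  simp [dot_cross_self]

theorem contDiffOn_gradK {F : RedAmbient → ℝ} {U : Set RedAmbient} (hU : IsOpen U)
    (hF : ContDiffOn ℝ ∞ F U) : ContDiffOn ℝ ∞ (gradK F) U :=
  contDiffOn_pi.2 fun _ => (hF.fderiv_of_isOpen hU (by simp)).clm_apply contDiffOn_const

theorem contDiffOn_gradGamma {F : RedAmbient → ℝ} {U : Set RedAmbient} (hU : IsOpen U)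
    (hF : ContDiffOn ℝ ∞ F U) : ContDiffOn ℝ ∞ (gradGamma F) U :=
  contDiffOn_pi.2 fun _ => (hF.fderiv_of_isOpen hU (by simp)).clm_apply contDiffOn_const

theorem contDiffOn_omega (hm : 0 < s.m) (hI : ∀ i, 0 < s.I i) (j : Fin 4) :
    ContDiffOn ℝ ∞ (s.omega j) {y | y.1 ≠ 0} := by
  have h1 : ContDiff ℝ ∞ s.invI := by unfold invI; fun_prop
  have h2 : ContDiff ℝ ∞ s.invJ := by unfold invJ; fun_prop
  have hI1 : ContDiff ℝ ∞ fun y : RedAmbient => s.invI y.1 := h1.comp contDiff_fst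
  have hI2 : ContDiff ℝ ∞ fun y : RedAmbient => s.invI y.2 := h1.comp contDiff_snd
  have hJ1 : ContDiff ℝ ∞ fun y : RedAmbient => s.invJ y.1 := h2.comp contDiff_fst
  have hJ2 : ContDiff ℝ ∞ fun y : RedAmbient => s.invJ y.2 := h2.comp contDiff_snd
  match j with
  | 0 => exact hI2.contDiffOn
  | 1 =>
    refine hI2.contDiffOn.sub (ContDiffOn.smul (contDiffOn_const.mul (ContDiffOn.div ?_ ?_ ?_))
      hI1.contDiffOn)
    · exact contDiffOn_dotProduct contDiffOn_snd hI1.contDiffOn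
    · exact (contDiffOn_dotProduct contDiffOn_fst contDiffOn_fst).add
        (contDiffOn_const.mul (contDiffOn_dotProduct contDiffOn_fst hI1.contDiffOn))
    · exact fun y hy => (omega_one_denom_pos hm hI hy).ne'
  | 2 =>
    refine hJ2.contDiffOn.add (ContDiffOn.smul (contDiffOn_const.mul (ContDiffOn.div ?_ ?_ ?_))
      hJ1.contDiffOn)
    · exact contDiffOn_dotProduct contDiffOn_snd hJ1.contDiffOn
    · exact (contDiffOn_dotProduct contDiffOn_fst contDiffOn_fst).sub
        (contDiffOn_const.mul (contDiffOn_dotProduct contDiffOn_fst hJ1.contDiffOn))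
    · exact fun y hy => (omega_two_denom_pos hm hI hy).ne'
  | 3 => exact hJ2.contDiffOn

theorem contDiffOn_bracketVector (hm : 0 < s.m) (hI : ∀ i, 0 < s.I i) (j : Fin 4) :
    ContDiffOn ℝ ∞ (s.bracketVector j) {y | y.1 ≠ 0} := by
  have h := contDiffOn_omega hm hI (s := s)
  match j with
  | 0 => exact contDiffOn_snd.sub ((h 0).const_smul _)
  | 1 =>
    exact (contDiffOn_snd.sub ((h 1).const_smul _)).add
      ((contDiffOn_const.mul (contDiffOn_dotProduct (h 1) contDiffOn_fst)).smul contDiffOn_fst)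
  | 2 =>
    exact contDiffOn_snd.sub
      ((contDiffOn_const.mul (contDiffOn_dotProduct (h 2) contDiffOn_fst)).smul contDiffOn_fst)
  | 3 => exact contDiffOn_snd

theorem contDiffOn_primedBracket (hm : 0 < s.m) (hI : ∀ i, 0 < s.I i) (j : Fin 4)
    {F G : RedAmbient → ℝ} {U : Set RedAmbient} (hU : IsOpen U) (hF : ContDiffOn ℝ ∞ F U)
    (hG : ContDiffOn ℝ ∞ G U) (hU0 : ∀ y ∈ U, y.1 ≠ 0) :
    ContDiffOn ℝ ∞ (s.primedBracket j F G) U := by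
  have hFK := contDiffOn_gradK hU hF
  have hGK := contDiffOn_gradK hU hG
  exact (contDiffOn_dotProduct ((contDiffOn_bracketVector hm hI j).mono hU0)
    (contDiffOn_cross hFK hGK)).neg.sub (contDiffOn_dotProduct contDiffOn_fst
      ((contDiffOn_cross hFK (contDiffOn_gradGamma hU hG)).sub
        (contDiffOn_cross hGK (contDiffOn_gradGamma hU hF))))

/-- The gauged bracket of two functions pulled back from the reduced space. -/
theorem gaugedBivector_bracket_pullback (hm : 0 < s.m) (hI : ∀ i, 0 < s.I i)
    (hA : DefinesGeneralizedRolling s.A) {j : Fin 4} (hj : s.A.rank = (j : ℕ))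
    (f g : SmoothFn reducedSpace) {U : Set RedAmbient} {F G : RedAmbient → ℝ} (hU : IsOpen U)
    (hF : ContDiffOn ℝ ∞ F U) (hG : ContDiffOn ℝ ∞ G U)
    (hfF : ∀ w : reducedSpace, (w : RedAmbient) ∈ U → f w = F w)
    (hgG : ∀ w : reducedSpace, (w : RedAmbient) ∈ U → g w = G w) (z : s.constraintManifold)
    (hz : s.orbitProjection z ∈ U) :
    (gaugedBivector hm hI).bracket
      (f.pullback s.orbitProjection s.contDiff_orbitProjection s.mapsTo_orbitProjection)
      (g.pullback s.orbitProjection s.contDiff_orbitProjection s.mapsTo_orbitProjection) z =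
      s.primedBracket j F G (s.orbitProjection z) := by
  have hval : ∀ (f : SmoothFn reducedSpace) (F : RedAmbient → ℝ), ContDiffOn ℝ ∞ F U →
      (∀ w : reducedSpace, (w : RedAmbient) ∈ U → f w = F w) →
      etaPart hm hI z (differential (f.pullback s.orbitProjection s.contDiff_orbitProjection
        s.mapsTo_orbitProjection) z) =
          gradGamma F (s.orbitProjection z) ⨯₃ (s.orbitProjection z).1 ∧
      kappaPart hm hI z (differential (f.pullback s.orbitProjection s.contDiff_orbitProjection
        s.mapsTo_orbitProjection) z) = gradK F (s.orbitProjection z) := by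
    intro f F hF hfF
    have hd : DifferentiableAt ℝ F (s.orbitProjection z) :=
      (hF.contDiffAt (hU.mem_nhds hz)).differentiableAt (by simp)
    have h1 : ∀ η κ : V3, differential (f.pullback s.orbitProjection s.contDiff_orbitProjection
        s.mapsTo_orbitProjection) z ((coordinates hm hI z).symm (η, κ)).1 =
        (gradGamma F (s.orbitProjection z) ⨯₃ (s.orbitProjection z).1) ⬝ᵥ η +
          gradK F (s.orbitProjection z) ⬝ᵥ κ := by
      intro η κ
      rw [differential_apply _ z (F ∘ s.orbitProjection) (s.orbitProjection ⁻¹' U)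
        (hU.preimage s.contDiff_orbitProjection.continuous) hz
        (hF.comp s.contDiff_orbitProjection.contDiffOn fun _ h => h)
          fun w hw => hfF ⟨s.orbitProjection w, s.mapsTo_orbitProjection w.2⟩ hw,
        fderiv_comp _ hd (s.contDiff_orbitProjection.differentiable (by simp) _)]
      change fderiv ℝ F _ (fderiv ℝ s.orbitProjection z (s.frame z η κ)) = _
      rw [fderiv_orbitProjection_frame hm hI, ← dot_cross_eq_cross_dot]
      exact dual_apply_prod (fderiv ℝ F (s.orbitProjection z)).toLinearMap _
    constructor
    · ext i
      exact (h1 (Pi.single i 1) 0).trans (by simp)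
    · ext i
      exact (h1 0 (Pi.single i 1)).trans (by simp)
  obtain ⟨hf1, hf2⟩ := hval f F hF hfF
  obtain ⟨hg1, hg2⟩ := hval g G hG hgG
  change bivectorAt hm hI s.gaugedVector z _ _ = _
  rw [bivectorAt_apply, hf1, hf2, hg1, hg2, primedBracket,
    bracketVector_orbitProjection hm hI hA hj z.2, dotProduct_sub]
  have h3 : ∀ u v : V3, (u ⨯₃ (s.orbitProjection z).1) ⬝ᵥ v =
      (s.orbitProjection z).1 ⬝ᵥ (v ⨯₃ u) := by
    intro u v
    rw [dotProduct_comm, triple_product_permutation, triple_product_permutation]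
  rw [h3, h3]
  ring

/-- The reduced bracket. -/
def reducedBracket (hm : 0 < s.m) (hI : ∀ i, 0 < s.I i) (hA : DefinesGeneralizedRolling s.A)
    {j : Fin 4} (hj : s.A.rank = (j : ℕ)) (f g : SmoothFn reducedSpace) :
    SmoothFn reducedSpace :=
  -- Any preimage of y serves: the bracket of pull-backs equals {F, G}' at y, which does not see the
  -- choice.
  ⟨fun y => (gaugedBivector hm hI).bracket
    (f.pullback s.orbitProjection s.contDiff_orbitProjection s.mapsTo_orbitProjection)
    (g.pullback s.orbitProjection s.contDiff_orbitProjection s.mapsTo_orbitProjection)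
    ⟨(surjOn_orbitProjection hm hI y.2).choose, (surjOn_orbitProjection hm hI y.2).choose_spec.1⟩,
    fun y => by
      obtain ⟨F, U, hU, hyU, hF, hfF⟩ := f.2 y
      obtain ⟨G, V, hV, hyV, hG, hgG⟩ := g.2 y
      -- The denominators in ranks 1 and 2 vanish at γ = 0, so the smooth extension {F, G}' is taken
      -- away from there.
      have hopen : IsOpen {y : RedAmbient | y.1 ≠ 0} :=
        isOpen_ne_fun continuous_fst continuous_const
      have hne : ∀ w ∈ reducedSpace, w.1 ≠ 0 := by
        intro w hw h0
        have hw' : w.1 ⬝ᵥ w.1 = 1 := hw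
        rw [h0] at hw'
        simp at hw'
      have hO := (hU.inter hV).inter hopen
      have hF' : ContDiffOn ℝ ∞ F (U ∩ V ∩ {y | y.1 ≠ 0}) := hF.mono fun w hw => hw.1.1
      have hG' : ContDiffOn ℝ ∞ G (U ∩ V ∩ {y | y.1 ≠ 0}) := hG.mono fun w hw => hw.1.2
      refine ⟨s.primedBracket j F G, _, hO, ⟨⟨hyU, hyV⟩, hne _ y.2⟩,
        contDiffOn_primedBracket hm hI j hO hF' hG' fun w hw => hw.2, fun w hw => ?_⟩
      have hspec := (surjOn_orbitProjection hm hI w.2).choose_spec.2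
      exact (gaugedBivector_bracket_pullback hm hI hA hj f g hO hF' hG'
        (fun w hw => hfF w hw.1.1) (fun w hw => hgG w hw.1.2)
        ⟨_, (surjOn_orbitProjection hm hI w.2).choose_spec.1⟩
        (Set.mem_of_eq_of_mem hspec hw)).trans (congrArg (s.primedBracket j F G) hspec)⟩

theorem isReduction_reducedBracket (hm : 0 < s.m) (hI : ∀ i, 0 < s.I i)
    (hA : DefinesGeneralizedRolling s.A) {j : Fin 4} (hj : s.A.rank = (j : ℕ)) :
    s.IsReduction (gaugedBivector hm hI) (reducedBracket hm hI hA hj) := by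
  intro f g z
  have hy := s.mapsTo_orbitProjection z.2
  obtain ⟨F, U, hU, hyU, hF, hfF⟩ := f.2 ⟨s.orbitProjection z, hy⟩
  obtain ⟨G, V, hV, hyV, hG, hgG⟩ := g.2 ⟨s.orbitProjection z, hy⟩
  have hspec := (surjOn_orbitProjection hm hI hy).choose_spec.2
  have h := fun z hz => gaugedBivector_bracket_pullback hm hI hA hj f g (hU.inter hV)
    (hF.mono Set.inter_subset_left) (hG.mono Set.inter_subset_right)
    (fun w hw => hfF w hw.1) (fun w hw => hgG w hw.2) z hz
  exact ((h ⟨_, (surjOn_orbitProjection hm hI hy).choose_spec.1⟩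
    (Set.mem_of_eq_of_mem hspec ⟨hyU, hyV⟩)).trans
      (congrArg (s.primedBracket j F G) hspec)).trans (h z ⟨hyU, hyV⟩).symm

/-- A reduction is determined by the bivector field, since the projection is onto. -/
theorem IsReduction.unique (hm : 0 < s.m) (hI : ∀ i, 0 < s.I i)
    {π : BivectorField s.constraintManifold}
    {br br' : SmoothFn reducedSpace → SmoothFn reducedSpace → SmoothFn reducedSpace}
    (h : s.IsReduction π br) (h' : s.IsReduction π br') : br = br' := by
  funext f g
  refine Subtype.ext (funext fun ⟨y, hy⟩ => ?_)
  obtain ⟨z, hz, rfl⟩ := surjOn_orbitProjection hm hI hy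
  exact (h f g ⟨z, hz⟩).trans (h' f g ⟨z, hz⟩).symm

theorem IsReduction.isRestrictionOf (hm : 0 < s.m) (hI : ∀ i, 0 < s.I i)
    (hA : DefinesGeneralizedRolling s.A) {j : Fin 4} (hj : s.A.rank = (j : ℕ))
    {br : SmoothFn reducedSpace → SmoothFn reducedSpace → SmoothFn reducedSpace}
    (h : s.IsReduction (gaugedBivector hm hI) br) : IsRestrictionOf (s.primedBracket j) br := by
  rintro f g U F G hU hF hG hfF hgG ⟨y, hy⟩ hyU
  obtain ⟨z, hz, rfl⟩ := surjOn_orbitProjection hm hI hy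
  exact (h f g ⟨z, hz⟩).trans
    (gaugedBivector_bracket_pullback hm hI hA hj f g hU hF hG hfF hgG ⟨z, hz⟩ hyU)

end Body

end Rolling

end

theorem mainTheorem8 (s : Rolling.Body) (hm : 0 < s.m) (hI : ∀ i, 0 < s.I i)
    (hA : Rolling.DefinesGeneralizedRolling s.A) (j : Fin 4) (hj : s.A.rank = (j : ℕ)) :
    s.IsOrbitSpace ∧
    (∀ (F : Rolling.RedAmbient → ℝ) (y : Rolling.RedAmbient), ContDiff ℝ ∞ F →
      s.primedBracket j F (fun w => w.1 ⬝ᵥ w.1) y = 0) ∧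
    (∃! π : Embedded.BivectorField s.constraintManifold, s.IsNonholonomicBivector π) ∧
    ∀ π : Embedded.BivectorField s.constraintManifold, s.IsNonholonomicBivector π →
      Embedded.IsDynamicalGauge s.gaugeForm π s.constrainedHamiltonian ∧
      (∃! πB : Embedded.BivectorField s.constraintManifold,
        Embedded.IsGaugeTransformOf s.gaugeForm π πB) ∧
      ∀ πB : Embedded.BivectorField s.constraintManifold,
        Embedded.IsGaugeTransformOf s.gaugeForm π πB →
          (∃! br, s.IsReduction πB br) ∧
          ∀ br, s.IsReduction πB br → Embedded.IsRestrictionOf (s.primedBracket j) br := by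
  have hnh := Rolling.Body.isNonholonomicBivector hm hI
  have hgauge := Rolling.Body.isGaugeTransformOf hm hI
  refine ⟨Rolling.Body.isOrbitSpace hm hI hA hj,
    fun F y _ => Rolling.Body.primedBracket_casimir j F y,
    ⟨_, hnh, fun π hπ => hπ.unique hnh⟩, fun π hπ => ?_⟩
  obtain rfl := Embedded.IsAssociatedBivector.unique hπ hnh
  refine ⟨Rolling.Body.isDynamicalGauge hm hI, ⟨_, hgauge, fun πB h => h.unique hgauge⟩,
    fun πB h => ?_⟩
  obtain rfl := h.unique hgauge
  exact ⟨⟨_, Rolling.Body.isReduction_reducedBracket hm hI hA hj,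
    fun br hbr => hbr.unique hm hI (Rolling.Body.isReduction_reducedBracket hm hI hA hj)⟩,
    fun br hbr => hbr.isRestrictionOf hm hI hA hj⟩
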